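/- **Notation.** For $a\in[-\infty,+\infty)$ write $a^+=\max\{a,0\}$, and for $t\ge 0$ write $\log^+t=\max\{0,\log t\}$ (with $\log^+0=0$). Let $m_N$ be Lebesgue measure on $\mathbb R^N$, let $B^N(x,r)$ be the open Euclidean ball, and let $\nu_N=m_N(B^N(0,1))$. Let $D\subset\mathbb R^N$ be open, $N\ge2$, and let $K\ge1$. A Lebesgue measurable function $u:D\to[-\infty,+\infty)$ is *$K$-quasinearly subharmonic* if $u^+\in\mathcal L^1_{\mathrm{loc}}(D)$ and, with $u_M:=\max\{u,-M\}+M$, $$u_M(x)\le\frac{K}{\nu_N r^N}\int_{B^N(x,r)}u_M(y)\,dm_N(y)$$ for all $M\ge0$ and all closed balls $\overline{B^N(x,r)}\subset D$, $r>0$. It is *quasinearly subharmonic* if it is $K$-quasinearly subharmonic for some $K\ge1$. **Corollary 4.2.** Let $K\ge1$, let $m\ge n\ge2$, and let $\Omega$ be a domain in $\mathbb R^{m+n}=\mathbb R^m\times\mathbb R^n$. For $y\in\mathbb R^n$ put $\Omega(y)=\{x\in\mathbb R^m:(x,y)\in\Omega\}$, and for $x\in\mathbb R^m$ put $\Omega(x)=\{y\in\mathbb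 R^n:(x,y)\in\Omega\}$. Let $u:\Omega\to[-\infty,+\infty)$ be Lebesgue measurable. Suppose: (a) for each $y\in\mathbb R^n$ the function $\Omega(y)\ni x\mapsto u(x,y)$ is $K$-quasinearly subharmonic; (b) for each $x\in\mathbb R^m$ the function $\Omega(x)\ni y\mapsto u(x,y)$ is $K$-quasinearly subharmonic; (c) there are strictly increasing surjections $\varphi:[0,+\infty)\to[0,+\infty)$ and $\phi:[0,+\infty)\to[0,+\infty)$ and $s_0,s_1\in\mathbb N$, $s_0<s_1$, such that (c1) $2K\,\phi^{-1}(e^{s-s_0})\le\phi^{-1}(e^s)$ for all real $s\ge s_1$; (c2) with $s_5:=\max\{\,s_0+s_1+3,\ s_0+\phi^{-1}(e^{s_1+3}),\ s_0+\log^+\phi(s_1+3)\,\}$, $$\int_{s_5}^{+\infty}\left[\frac{\phi^{-1}(e^{s+2})}{\phi^{-1}(e^s)}\cdot\frac1{\varphi(s-s_0)}\right]^{\frac1{m-1}}\left(\int_{s_5+s_0+2}^{s+s_0+2}\left[\frac{\phi^{-1}(e^{t+2})}{\phi^{-1}(e^t)}\right]^{\frac1{n-1}}dt\right)^{\frac{n-1}{m-1}}ds<+\infty;$$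 (c3) $\varphi\circ\log^+\phi(u^+)\in\mathcal L^1_{\mathrm{loc}}(\Omega)$. Then $u$ is quasinearly subharmonic in $\Omega$. -/

import Mathlib

open MeasureTheory Set
open scoped ENNReal NNReal

noncomputable section

namespace Quasinearly

/-- The positive part `u⁺ = max {u, 0}` of an extended real number `a < +∞`, as an element of
`[0, +∞)`. -/
def plus (a : EReal) : ℝ≥0 := a.toENNReal.toNNReal

/-- `u_M = max {u, -M} + M` at a point where `u` has the value `a`. For `M ≥ 0` this is a
nonnegative number, so it may be recorded in `[0, +∞]`. -/
def truncate (M : ℝ) (a : EReal) : ℝ≥0∞ :=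
  (max a ((-M : ℝ) : EReal) + ((M : ℝ) : EReal)).toENNReal

/-- `u : D → [-∞, +∞)` is `K`-quasinearly subharmonic on the open set `D` of `ℝ^N`. The values of
`u` outside `D` play no role. The mean `⨍⁻` over the ball `B(x, r)` is the Lebesgue integral over
the ball divided by its volume `ν_N r^N`. -/
structure IsKQuasinearlySubharmonicOn {N : ℕ} (K : ℝ) (u : EuclideanSpace ℝ (Fin N) → EReal)
    (D : Set (EuclideanSpace ℝ (Fin N))) : Prop where
  one_le : 1 ≤ K
  lt_top : ∀ x ∈ D, u x < ⊤
  measurable : AEMeasurable u (volume.restrict D)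
  locallyIntegrable : LocallyIntegrableOn (fun x => (plus (u x) : ℝ)) D volume
  mean_value : ∀ M : ℝ, 0 ≤ M → ∀ (x : EuclideanSpace ℝ (Fin N)) (r : ℝ), 0 < r →
    Metric.closedBall x r ⊆ D →
      truncate M (u x) ≤ ENNReal.ofReal K * ⨍⁻ y in Metric.ball x r, truncate M (u y) ∂volume

/-- `u` is quasinearly subharmonic on `D`: it is `K`-quasinearly subharmonic for some `K ≥ 1`. -/
def IsQuasinearlySubharmonicOn {N : ℕ} (u : EuclideanSpace ℝ (Fin N) → EReal)
    (D : Set (EuclideanSpace ℝ (Fin N))) : Prop :=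
  ∃ K : ℝ, IsKQuasinearlySubharmonicOn K u D

/-- The point `(x, y)` of `ℝ^(m+n) = ℝ^m × ℝ^n`. -/
def pair {m n : ℕ} (x : EuclideanSpace ℝ (Fin m)) (y : EuclideanSpace ℝ (Fin n)) :
    EuclideanSpace ℝ (Fin (m + n)) :=
  EuclideanSpace.finAddEquivProd.symm (x, y)

/-- `ϕ⁻¹(e^s)`. A strictly increasing surjection of `[0, +∞)` onto itself is the same thing as an
order isomorphism `ℝ≥0 ≃o ℝ≥0`. -/
def invExp (ϕ : ℝ≥0 ≃o ℝ≥0) (s : ℝ) : ℝ := ϕ.symm (Real.exp s).toNNReal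

/-- `log⁺ ϕ(t)`, with `log⁺ a = max {0, log a}`. -/
def logPlus (ϕ : ℝ≥0 ≃o ℝ≥0) (t : ℝ≥0) : ℝ := Real.posLog (ϕ t : ℝ)

/-- The lower limit of integration
`s₅ = max {s₀ + s₁ + 3, s₀ + ϕ⁻¹(e^(s₁+3)), s₀ + log⁺ ϕ(s₁+3)}`. For `ψ = φ ∘ log⁺ ∘ ϕ` one has
`(ψ⁻¹ ∘ φ)(s) = ϕ⁻¹(e^s)` for `s > 0` and `(φ⁻¹ ∘ ψ)(t) = log⁺ ϕ(t)`. -/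
def sFive (ϕ : ℝ≥0 ≃o ℝ≥0) (s₀ s₁ : ℕ) : ℝ :=
  max ((s₀ : ℝ) + s₁ + 3) (max (s₀ + invExp ϕ (s₁ + 3)) (s₀ + logPlus ϕ (s₁ + 3)))

/-- The integrand (in `s`) of the double integral. For `s ≥ s₅` one has `s - s₀ > 0`, and the inner
integrand is continuous and positive. -/
def integrand (m n : ℕ) (φ ϕ : ℝ≥0 ≃o ℝ≥0) (s₀ s₁ : ℕ) (s : ℝ) : ℝ :=
  (invExp ϕ (s + 2) / invExp ϕ s * (1 / (φ (s - s₀).toNNReal : ℝ))) ^ (1 / ((m : ℝ) - 1)) *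
    (∫ t in (sFive ϕ s₀ s₁ + s₀ + 2)..(s + s₀ + 2),
      (invExp ϕ (t + 2) / invExp ϕ t) ^ (1 / ((n : ℝ) - 1))) ^ (((n : ℝ) - 1) / ((m : ℝ) - 1))

end Quasinearly

end

/-!
The positive part `v = u⁺` has the mean value property in each variable separately, and everything
reduces to showing that `v` is locally bounded. Indeed the joint mean value inequality for the
truncations `u_M` follows at once from the two separate ones, because the product of two balls of
radius `r / 2` fills a fixed proportion of a ball of radius `r` (`truncate_le_of_separately`).
Boundedness is needed only for the local integrability of `u⁺`.

Boundedness comes from Domar's method. Let `A i = ϕ⁻¹(e^(b + i))`. If a function `w` on `ℝ^N` with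
the mean value property reaches `A (i + s₀)` at a point, then in a ball about this point either `w`
reaches `A (i + s₀ + 1)`, or the set `{A i ≤ w < A (i + s₀ + 1)}` takes up a definite part of the
ball; the inequality `2 K A i ≤ A (i + s₀)` absorbs the values below `A i`. Moving from level to
level gives a chain which, `w` being bounded near the starting point, must leave the ball of radius `δ`
(`SubmeanOn.exists_le_sum_radii`). Hölder's inequality for the sum of its step lengths bounds
`∫ H` from below, for every `H` which is at least `q i` where `w ≥ A i`
(`SubmeanOn.domar_estimate`).

This estimate is used twice (`exists_bound_of_separately_submean`). In `ℝ^m`, for fixed `y` and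
`H = φ ∘ log⁺ ∘ ϕ ∘ v`, it shows that `F y = ∫ H x y dx` is at least a constant times
`(∑_{i ≥ l} g i)^(1 - m)` wherever `v` reaches the corresponding level, where `g` is
`innerWeight`. In `ℝ^n`, for fixed `x`, it is applied with `F` as the new `H`; as `F` is
integrable, it bounds `v` as soon as the series `∑ w l (∑_{i ≥ l} g i)^p` converges, where `w` is
`outerWeight` and `p = (m - 1) / (n - 1)`. Taking the variable of larger dimension first makes
`p ≥ 1`, so that a Hardy inequality (`summable_mul_tailSum_rpow`) reduces this to the convergence
of `∑ g l (w 0 + ⋯ + w l)^(1 / p)`, which is dominated by the double integral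
(`summable_innerWeight_mul`).
-/

noncomputable section

namespace Quasinearly

/-! ### A Hardy-type inequality for series -/

lemma rpow_le_rpow_add_mul_sub {θ a b : ℝ} (hθ : 0 < θ) (hθ1 : θ ≤ 1) (ha : 0 ≤ a) (hb : 0 < b) :
    a ^ θ ≤ b ^ θ + θ * b ^ (θ - 1) * (a - b) := by
  have hs : -1 ≤ a / b - 1 := by linarith [div_nonneg ha hb.le]
  have h := rpow_one_add_le_one_add_mul_self hs hθ.le hθ1
  rw [add_sub_cancel, Real.div_rpow ha hb.le, div_le_iff₀ (Real.rpow_pos_of_pos hb θ)] at h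
  have hbθ : b ^ (θ - 1) = b ^ θ / b := Real.rpow_sub_one hb.ne' θ
  calc a ^ θ ≤ (1 + θ * (a / b - 1)) * b ^ θ := h
    _ = b ^ θ + θ * b ^ (θ - 1) * (a - b) := by
      rw [hbθ]; field_simp

lemma sum_mul_rpow_partialSum_le {θ : ℝ} (hθ : 0 < θ) (hθ1 : θ ≤ 1) {w : ℕ → ℝ}
    (hw : ∀ l, 0 < w l) (n : ℕ) :
    ∑ l ∈ Finset.range n, w l * (∑ i ∈ Finset.range (l + 1), w i) ^ (θ - 1) ≤
      θ⁻¹ * (∑ i ∈ Finset.range n, w i) ^ θ := by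
  induction n with
  | zero => simp [Real.zero_rpow hθ.ne']
  | succ n ih =>
    have ha : 0 ≤ ∑ i ∈ Finset.range n, w i := Finset.sum_nonneg fun i _ => (hw i).le
    have hb : 0 < ∑ i ∈ Finset.range (n + 1), w i :=
      Finset.sum_pos (fun i _ => hw i) (by simp)
    have h := rpow_le_rpow_add_mul_sub hθ hθ1 ha hb
    rw [Finset.sum_range_succ (fun l => w l * _)]
    have hab : ∑ i ∈ Finset.range n, w i - ∑ i ∈ Finset.range (n + 1), w i = -w n := by
      rw [Finset.sum_range_succ]; ring
    rw [hab] at h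
    have h2 := mul_le_mul_of_nonneg_left h (inv_pos.2 hθ).le
    have h3 : θ⁻¹ * ((∑ i ∈ Finset.range (n + 1), w i) ^ θ +
        θ * (∑ i ∈ Finset.range (n + 1), w i) ^ (θ - 1) * -w n) =
        θ⁻¹ * (∑ i ∈ Finset.range (n + 1), w i) ^ θ -
          w n * (∑ i ∈ Finset.range (n + 1), w i) ^ (θ - 1) := by
      field_simp; ring
    linarith

/-- The tail `∑_{i ≥ l} g i`, written as a sum over all indices. -/
def tailSum (g : ℕ → ℝ) (l : ℕ) : ℝ := ∑' i, (Ici l).indicator g i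

lemma sum_Ico_le_tailSum {g : ℕ → ℝ} (hg : ∀ i, 0 ≤ g i) (hs : Summable g) (l k : ℕ) :
    ∑ i ∈ Finset.Ico l k, g i ≤ tailSum g l := by
  have h := (hs.indicator (Ici l)).sum_le_tsum (Finset.Ico l k)
    fun i _ => indicator_nonneg (fun i _ => hg i) i
  refine le_trans (le_of_eq (Finset.sum_congr rfl fun i hi => ?_)) h
  rw [indicator_of_mem (show i ∈ Ici l from (Finset.mem_Ico.1 hi).1)]

lemma tailSum_pos {g : ℕ → ℝ} (hg : ∀ i, 0 < g i) (hs : Summable g) (l : ℕ) :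
    0 < tailSum g l := by
  have := sum_Ico_le_tailSum (fun i => (hg i).le) hs l (l + 1)
  simp only [Nat.Ico_succ_singleton, Finset.sum_singleton] at this
  exact (hg l).trans_le this

/-- A Hardy inequality with weights: with `W l = w 0 + ⋯ + w l` and `θ = 1 / p ∈ (0, 1]`, the
convergence of `∑ g l (W l)^θ` implies that of `∑ w l (∑_{i ≥ l} g i)^p`. It replaces Minkowski's
integral inequality. -/
lemma summable_mul_tailSum_rpow {θ : ℝ} (hθ : 0 < θ) (hθ1 : θ ≤ 1) {g w : ℕ → ℝ}
    (hg : ∀ i, 0 < g i) (hw : ∀ i, 0 < w i) (hsg : Summable g)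
    (hs : Summable fun l => g l * (∑ i ∈ Finset.range (l + 1), w i) ^ θ) :
    Summable fun l => w l * tailSum g l ^ θ⁻¹ := by
  set W : ℕ → ℝ := fun l => ∑ i ∈ Finset.range (l + 1), w i with hW
  set T : ℝ := ∑' l, g l * W l ^ θ with hT
  have hWpos : ∀ l, 0 < W l := fun l => Finset.sum_pos (fun i _ => hw i) (by simp)
  have hWmono : Monotone W := by
    refine monotone_nat_of_le_succ fun l => ?_
    simp only [hW]
    rw [Finset.sum_range_succ _ (l + 1)]
    linarith [hw (l + 1)]
  have hfpos := tailSum_pos hg hsg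
  have hterm : ∀ i, 0 ≤ g i * W i ^ θ :=
    fun i => mul_nonneg (hg i).le (Real.rpow_nonneg (hWpos i).le _)
  have hTnn : 0 ≤ T := tsum_nonneg hterm
  have hfT : ∀ l, tailSum g l * W l ^ θ ≤ T := by
    intro l
    rw [tailSum, ← tsum_mul_right]
    refine Summable.tsum_le_tsum (fun i => ?_) ((hsg.indicator _).mul_right _) hs
    by_cases hi : l ≤ i
    · rw [indicator_of_mem (show i ∈ Ici l from hi)]
      have := hWmono hi
      have := hWpos l
      have := hg i
      gcongr
    · rw [indicator_of_notMem (show i ∉ Ici l from hi), zero_mul]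
      exact hterm i
  have hp : 0 ≤ θ⁻¹ - 1 := by
    have := (one_le_inv₀ hθ).2 hθ1
    linarith
  -- Only one factor `tailSum g l` is kept; the others are replaced by the bound `T / (W l)^θ`.
  have hpow : ∀ l, w l * tailSum g l ^ θ⁻¹ ≤
      T ^ (θ⁻¹ - 1) * ((w l * W l ^ (θ - 1)) * tailSum g l) := by
    intro l
    have h1 : tailSum g l ≤ T * W l ^ (-θ) := by
      rw [Real.rpow_neg (hWpos l).le, ← div_eq_mul_inv,
        le_div_iff₀ (Real.rpow_pos_of_pos (hWpos l) _)]
      exact hfT l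
    have h2 : tailSum g l ^ (θ⁻¹ - 1) ≤ T ^ (θ⁻¹ - 1) * W l ^ (θ - 1) := by
      refine (Real.rpow_le_rpow (hfpos l).le h1 hp).trans (le_of_eq ?_)
      rw [Real.mul_rpow hTnn (Real.rpow_nonneg (hWpos l).le _), ← Real.rpow_mul (hWpos l).le]
      congr 2
      field_simp
      ring
    have h3 : tailSum g l ^ θ⁻¹ = tailSum g l ^ (θ⁻¹ - 1) * tailSum g l := by
      rw [Real.rpow_sub_one (hfpos l).ne', div_mul_cancel₀ _ (hfpos l).ne']
    rw [h3]
    have h4 := mul_le_mul_of_nonneg_left h2 (mul_nonneg (hw l).le (hfpos l).le)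
    calc _ = w l * tailSum g l * tailSum g l ^ (θ⁻¹ - 1) := by ring
      _ ≤ _ := h4
      _ = _ := by ring
  have hc : ∀ l, 0 ≤ w l * W l ^ (θ - 1) :=
    fun l => mul_nonneg (hw l).le (Real.rpow_nonneg (hWpos l).le _)
  refine summable_of_sum_range_le (c := T ^ (θ⁻¹ - 1) * (θ⁻¹ * T))
    (fun l => mul_nonneg (hw l).le (Real.rpow_nonneg (hfpos l).le _)) fun n => ?_
  refine (Finset.sum_le_sum fun l _ => hpow l).trans ?_
  rw [← Finset.mul_sum]
  refine mul_le_mul_of_nonneg_left ?_ (Real.rpow_nonneg hTnn _)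
  simp only [tailSum]
  simp_rw [← tsum_mul_left]
  rw [← Summable.tsum_finsetSum fun l _ => (hsg.indicator (Ici l)).mul_left _]
  rw [hT, ← tsum_mul_left]
  refine Summable.tsum_le_tsum (fun i => ?_)
    (summable_sum fun l _ => (hsg.indicator (Ici l)).mul_left _) (hs.mul_left _)
  have h1 : ∑ l ∈ Finset.range n, w l * W l ^ (θ - 1) * (Ici l).indicator g i ≤
      ∑ l ∈ Finset.range (i + 1), w l * W l ^ (θ - 1) * g i := by
    calc _ = ∑ l ∈ Finset.range n, if l < i + 1 then w l * W l ^ (θ - 1) * g i else 0 := by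
          refine Finset.sum_congr rfl fun l _ => ?_
          by_cases hl : l ≤ i
          · rw [indicator_of_mem (show i ∈ Ici l from hl), if_pos (by omega)]
          · rw [indicator_of_notMem (show i ∉ Ici l from hl), if_neg (by omega), mul_zero]
      _ = ∑ l ∈ (Finset.range n).filter (· < i + 1), w l * W l ^ (θ - 1) * g i :=
          (Finset.sum_filter _ _).symm
      _ ≤ _ := by
          refine Finset.sum_le_sum_of_subset_of_nonneg (fun l hl => ?_)
            fun l _ _ => mul_nonneg (hc l) (hg i).le
          simp only [Finset.mem_filter] at hl
          simpa using hl.2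
  refine h1.trans ?_
  rw [← Finset.sum_mul]
  have h2 := mul_le_mul_of_nonneg_right
    (sum_mul_rpow_partialSum_le hθ hθ1 hw (i + 1)) (hg i).le
  refine h2.trans (le_of_eq ?_)
  simp only [hW]
  ring

/-! ### Functions with a submean property and Domar's chains -/

/-- The function `w` satisfies the mean value inequality with constant `K` on all closed balls
contained in `D`. -/
def SubmeanOn {N : ℕ} (K : ℝ) (w : EuclideanSpace ℝ (Fin N) → ℝ≥0)
    (D : Set (EuclideanSpace ℝ (Fin N))) : Prop :=
  ∀ (x : EuclideanSpace ℝ (Fin N)) (r : ℝ), 0 < r → Metric.closedBall x r ⊆ D →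
    (w x : ℝ≥0∞) ≤ ENNReal.ofReal K * ⨍⁻ y in Metric.ball x r, (w y : ℝ≥0∞) ∂volume

/-- The volume `ν_N` of the unit ball of `ℝ^N`. -/
def unitBallVolume (N : ℕ) : ℝ := volume.real (Metric.ball (0 : EuclideanSpace ℝ (Fin N)) 1)

lemma unitBallVolume_pos (N : ℕ) : 0 < unitBallVolume N :=
  ENNReal.toReal_pos (Metric.measure_ball_pos _ _ one_pos).ne' measure_ball_lt_top.ne

lemma volume_ball_eq {N : ℕ} (x : EuclideanSpace ℝ (Fin N)) {r : ℝ} (hr : 0 < r) :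
    volume (Metric.ball x r) = ENNReal.ofReal (r ^ N * unitBallVolume N) := by
  rw [Measure.addHaar_ball_of_pos _ _ hr, ENNReal.ofReal_mul (by positivity), finrank_euclideanSpace,
    Fintype.card_fin, unitBallVolume, measureReal_def,
    ENNReal.ofReal_toReal measure_ball_lt_top.ne]

variable {N : ℕ}

/-- If `w` stayed below `U` on a ball centred at a point where `w ≥ A`, then the level set
`{L ≤ w < U}` would take up at least the proportion `A / (2 K U)` of the ball: since
`2 K L ≤ A`, the values below `L` account for at most half of the mean value inequality. -/
lemma SubmeanOn.exists_mem_ball_le {K : ℝ} (hK : 1 ≤ K) {w : EuclideanSpace ℝ (Fin N) → ℝ≥0}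
    {S : Set (EuclideanSpace ℝ (Fin N))} (hw : SubmeanOn K w S) (hS : volume S ≠ ⊤)
    {x : EuclideanSpace ℝ (Fin N)} {r : ℝ} (hr : 0 < r) (hx : Metric.closedBall x r ⊆ S)
    {L A U : ℝ} (hL : 0 ≤ L) (hLA : 2 * K * L ≤ A) (hA : A ≤ w x) (hU : 0 < U)
    (hvol : 2 * K * U * volume.real {y ∈ S | L ≤ w y ∧ (w y : ℝ) < U} <
      A * (r ^ N * unitBallVolume N)) :
    ∃ y ∈ Metric.ball x r, U ≤ w y := by
  by_contra! h
  set E := {y ∈ S | L ≤ w y ∧ (w y : ℝ) < U} with hE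
  set V := r ^ N * unitBallVolume N with hV
  have hVpos : 0 < V := mul_pos (pow_pos hr N) (unitBallVolume_pos N)
  have hEfin : volume E ≠ ⊤ := measure_ne_top_of_subset (sep_subset _ _) hS
  have hint : ∫⁻ y in Metric.ball x r, (w y : ℝ≥0∞) ≤
      ENNReal.ofReal (L * V + U * volume.real E) := by
    calc ∫⁻ y in Metric.ball x r, (w y : ℝ≥0∞)
        ≤ ∫⁻ y in Metric.ball x r, (ENNReal.ofReal L + E.indicator (fun _ => ENNReal.ofReal U) y) := by
          refine setLIntegral_mono' Metric.isOpen_ball.measurableSet fun y hy => ?_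
          rw [← ENNReal.ofReal_coe_nnreal]
          by_cases hyL : (w y : ℝ) ≤ L
          · exact (ENNReal.ofReal_le_ofReal hyL).trans le_self_add
          · have hyE : y ∈ E := ⟨hx (Metric.ball_subset_closedBall hy), (not_le.1 hyL).le, h y hy⟩
            rw [indicator_of_mem hyE]
            exact (ENNReal.ofReal_le_ofReal (h y hy).le).trans le_add_self
      _ = ENNReal.ofReal L * volume (Metric.ball x r) +
          ∫⁻ y in Metric.ball x r, E.indicator (fun _ => ENNReal.ofReal U) y := by
          rw [lintegral_add_left measurable_const, setLIntegral_const]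
      _ ≤ ENNReal.ofReal L * volume (Metric.ball x r) + ENNReal.ofReal U * volume E := by
          gcongr
          exact (lintegral_indicator_const_le _ _).trans
            (mul_le_mul_right (Measure.restrict_apply_le _ _) _)
      _ = _ := by
          rw [volume_ball_eq x hr, ← ENNReal.ofReal_toReal hEfin, ← measureReal_def,
            ← ENNReal.ofReal_mul hL, ← ENNReal.ofReal_mul hU.le, ← ENNReal.ofReal_add]
          · positivity
          · positivity
  have h1 : (w x : ℝ≥0∞) ≤ ENNReal.ofReal (K * ((L * V + U * volume.real E) / V)) := by
    refine (hw x r hr hx).trans ?_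
    rw [setLAverage_eq, volume_ball_eq x hr, ENNReal.ofReal_mul (p := K) (by linarith),
      ENNReal.ofReal_div_of_pos hVpos]
    gcongr
  have h2 : (w x : ℝ) ≤ K * ((L * V + U * volume.real E) / V) := by
    rw [← ENNReal.ofReal_coe_nnreal, ENNReal.ofReal_le_ofReal_iff] at h1
    · exact h1
    · positivity
  rw [mul_div_assoc', le_div_iff₀ hVpos] at h2
  nlinarith [mul_le_mul_of_nonneg_right hA hVpos.le, mul_le_mul_of_nonneg_right hLA hVpos.le]

lemma sum_Ico_one_half_pow_le (j k : ℕ) : ∑ i ∈ Finset.Ico j k, (1 / 2 : ℝ) ^ i ≤ 2 := by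
  refine le_trans (Finset.sum_le_sum_of_subset_of_nonneg (t := Finset.range k) ?_ ?_)
    (sum_geometric_two_le k)
  · intro i hi
    simpa using (Finset.mem_Ico.1 hi).2
  · intros; positivity

/-- Domar's chain. Starting from a point where `w` is at least the `j`-th level, one moves to a
point where `w` is at least the next level, by a distance controlled by the volume of the set
where `w` lies near the current level. As `w` is bounded, the chain must leave the ball of radius
`δ`, so the step lengths add up to a fixed part of `δ`. -/
lemma SubmeanOn.exists_le_sum_radii (hN : N ≠ 0) {K : ℝ} (hK : 1 ≤ K)
    {w : EuclideanSpace ℝ (Fin N) → ℝ≥0}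
    {a : EuclideanSpace ℝ (Fin N)} {δ : ℝ} (hδ : 0 < δ)
    (hw : SubmeanOn K w (Metric.closedBall a δ))
    {M : ℝ} (hM : ∀ y ∈ Metric.closedBall a δ, (w y : ℝ) ≤ M)
    {A : ℕ → ℝ} (hApos : ∀ i, 0 < A i) (hAtop : Filter.Tendsto A Filter.atTop Filter.atTop)
    {s₀ : ℕ} (hA : ∀ i, 2 * K * A i ≤ A (i + s₀)) {j : ℕ} (hj : A (j + s₀) ≤ w a) :
    ∃ k, δ / 2 ≤ ∑ i ∈ Finset.Ico j k, (2 * K / unitBallVolume N *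
      (A (i + s₀ + 1) / A (i + s₀) *
        volume.real {y ∈ Metric.closedBall a δ | A i ≤ w y ∧ (w y : ℝ) < A (i + s₀ + 1)}))
          ^ (1 / (N : ℝ)) := by
  by_contra! h
  set R : ℕ → ℝ := fun i => (2 * K / unitBallVolume N *
      (A (i + s₀ + 1) / A (i + s₀) *
        volume.real {y ∈ Metric.closedBall a δ | A i ≤ w y ∧ (w y : ℝ) < A (i + s₀ + 1)}))
          ^ (1 / (N : ℝ)) with hR
  have hν := unitBallVolume_pos N
  have hbase : ∀ i, 0 ≤ 2 * K / unitBallVolume N * (A (i + s₀ + 1) / A (i + s₀) *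
        volume.real {y ∈ Metric.closedBall a δ | A i ≤ w y ∧ (w y : ℝ) < A (i + s₀ + 1)}) := by
    intro i
    have := hApos (i + s₀)
    have := hApos (i + s₀ + 1)
    positivity
  have hR0 : ∀ i, 0 ≤ R i := fun i => Real.rpow_nonneg (hbase i) _
  -- The added geometric series keeps the radii positive where the level set is a null set.
  set r : ℕ → ℝ := fun i => R i + δ / 4 * (1 / 2) ^ i with hr
  have hrR : ∀ i, R i < r i := fun i => by
    simp only [hr]
    have : 0 < δ / 4 * (1 / 2) ^ i := by positivity
    linarith
  have hrpos : ∀ i, 0 < r i := fun i => (hR0 i).trans_lt (hrR i)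
  have hrsum : ∀ k, ∑ i ∈ Finset.Ico j k, r i ≤ δ := by
    intro k
    simp only [hr]
    rw [Finset.sum_add_distrib, ← Finset.mul_sum]
    have h1 := h k
    have h2 := mul_le_mul_of_nonneg_left (sum_Ico_one_half_pow_le j k) (by linarith : 0 ≤ δ / 4)
    linarith
  have hchain : ∀ l, ∃ x, dist x a ≤ ∑ i ∈ Finset.Ico j (j + l), r i ∧
      A (j + l + s₀) ≤ w x := by
    intro l
    induction l with
    | zero => exact ⟨a, by simp, by simpa using hj⟩
    | succ l ih =>
      obtain ⟨x, hxa, hx⟩ := ih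
      have hsum : ∑ i ∈ Finset.Ico j (j + (l + 1)), r i =
          ∑ i ∈ Finset.Ico j (j + l), r i + r (j + l) := by
        rw [← add_assoc, Finset.sum_Ico_succ_top (by omega)]
      have hsub : Metric.closedBall x (r (j + l)) ⊆ Metric.closedBall a δ := by
        refine Metric.closedBall_subset_closedBall' ?_
        linarith [hrsum (j + (l + 1))]
      have hUpos := hApos (j + l + s₀ + 1)
      have hApos' := hApos (j + l + s₀)
      obtain ⟨y, hy, hyU⟩ := hw.exists_mem_ball_le hK measure_closedBall_lt_top.ne
        (hrpos (j + l)) hsub (hApos (j + l)).le (hA (j + l)) hx hUpos (by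
          have h1 : R (j + l) ^ N < r (j + l) ^ N := pow_lt_pow_left₀ (hrR _) (hR0 _) hN
          have h2 := Real.rpow_inv_natCast_pow (hbase (j + l)) hN
          rw [← one_div] at h2
          rw [show R (j + l) ^ N = _ from h2] at h1
          have h3 := mul_lt_mul_of_pos_left h1 (mul_pos hApos' hν)
          refine lt_of_le_of_lt (le_of_eq ?_) (lt_of_lt_of_le h3 (le_of_eq ?_))
          · field_simp
          · ring)
      refine ⟨y, ?_, ?_⟩
      · rw [hsum]
        have := dist_triangle y x a
        have := Metric.mem_ball.1 hy
        linarith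
      · have e : j + (l + 1) + s₀ = j + l + s₀ + 1 := by ring
        rw [e]; exact hyU
  obtain ⟨n, hn⟩ := Filter.eventually_atTop.1 (hAtop.eventually_gt_atTop M)
  obtain ⟨x, hxa, hx⟩ := hchain n
  have := hM x (Metric.mem_closedBall.2 (hxa.trans (hrsum _)))
  linarith [hn (j + n + s₀) (by omega)]

/-- Each value lies in at most `s₀ + 1` of the intervals `[A i, A (i + s₀ + 1))`. -/
lemma sum_level_le {A : ℕ → ℝ} (hA : StrictMono A) {s₀ : ℕ} (t : ℝ) (H : ℝ≥0∞) (q : ℕ → ℝ≥0∞)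
    (I : Finset ℕ) (hq : ∀ i ∈ I, A i ≤ t → q i ≤ H) :
    ∑ i ∈ I, (if A i ≤ t ∧ t < A (i + s₀ + 1) then q i else 0) ≤ (s₀ + 1 : ℕ) * H := by
  rw [← Finset.sum_filter]
  set F := I.filter fun i => A i ≤ t ∧ t < A (i + s₀ + 1) with hF
  have hcard : F.card ≤ s₀ + 1 := by
    rcases F.eq_empty_or_nonempty with h0 | h0
    · simp [h0]
    · have hsub : F ⊆ Finset.Ico (F.min' h0) (F.min' h0 + (s₀ + 1)) := by
        intro i hi
        have hm := F.min'_mem h0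
        rw [Finset.mem_Ico]
        refine ⟨F.min'_le i hi, ?_⟩
        have h1 := (Finset.mem_filter.1 hi).2.1
        have h2 := (Finset.mem_filter.1 hm).2.2
        exact hA.lt_iff_lt.1 (h1.trans_lt h2)
      simpa using Finset.card_le_card hsub
  calc ∑ i ∈ F, q i ≤ F.card • H := Finset.sum_le_card_nsmul _ _ _ fun i hi =>
        hq i (Finset.mem_filter.1 hi).1 (Finset.mem_filter.1 hi).2.1
    _ ≤ (s₀ + 1 : ℕ) * H := by
        rw [nsmul_eq_mul]
        gcongr

lemma sum_mul_volume_level_le {S : Set (EuclideanSpace ℝ (Fin N))} (hS : MeasurableSet S)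
    (hSfin : volume S ≠ ⊤)
    {w : EuclideanSpace ℝ (Fin N) → ℝ≥0} (hwm : AEMeasurable w (volume.restrict S))
    {A : ℕ → ℝ} (hA : StrictMono A) {s₀ : ℕ} {q : ℕ → ℝ} (hq0 : ∀ i, 0 ≤ q i)
    {H : EuclideanSpace ℝ (Fin N) → ℝ≥0∞} {j : ℕ}
    (hq : ∀ i, j ≤ i → ∀ y ∈ S, A i ≤ w y → ENNReal.ofReal (q i) ≤ H y)
    {I : ℝ} (hI0 : 0 ≤ I) (hI : ∫⁻ y in S, H y ≤ ENNReal.ofReal I) (k : ℕ) :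
    ∑ i ∈ Finset.Ico j k, q i * volume.real {y ∈ S | A i ≤ w y ∧ (w y : ℝ) < A (i + s₀ + 1)} ≤
      (s₀ + 1) * I := by
  set E : ℕ → Set (EuclideanSpace ℝ (Fin N)) :=
    fun i => {y | A i ≤ w y ∧ (w y : ℝ) < A (i + s₀ + 1)} with hE
  have hwm' : AEMeasurable (fun y => (w y : ℝ)) (volume.restrict S) := hwm.coe_nnreal_real
  have hEm : ∀ i, NullMeasurableSet (E i) (volume.restrict S) := fun i =>
    (nullMeasurableSet_le aemeasurable_const hwm').inter
      (nullMeasurableSet_lt hwm' aemeasurable_const)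
  have hvol : ∀ i, volume {y ∈ S | A i ≤ w y ∧ (w y : ℝ) < A (i + s₀ + 1)} =
      volume.restrict S (E i) := by
    intro i
    rw [Measure.restrict_apply' hS, inter_comm]
    rfl
  have hfin : ∀ i, volume.restrict S (E i) ≠ ⊤ := fun i =>
    ((measure_mono (subset_univ _)).trans_lt (by simpa using hSfin.lt_top)).ne
  have hmain : ∑ i ∈ Finset.Ico j k, ENNReal.ofReal (q i) * volume.restrict S (E i) ≤
      ENNReal.ofReal ((s₀ + 1) * I) := by
    calc ∑ i ∈ Finset.Ico j k, ENNReal.ofReal (q i) * volume.restrict S (E i)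
        = ∑ i ∈ Finset.Ico j k, ∫⁻ y in S, (E i).indicator (fun _ => ENNReal.ofReal (q i)) y :=
          Finset.sum_congr rfl fun i _ => (lintegral_indicator_const₀ (hEm i) _).symm
      _ = ∫⁻ y in S, ∑ i ∈ Finset.Ico j k, (E i).indicator (fun _ => ENNReal.ofReal (q i)) y :=
          (lintegral_finsetSum' _ fun i _ => aemeasurable_const.indicator₀ (hEm i)).symm
      _ ≤ ∫⁻ y in S, (s₀ + 1 : ℕ) * H y := by
          refine setLIntegral_mono' hS fun y hy => ?_
          refine le_trans (le_of_eq (Finset.sum_congr rfl fun i _ => ?_))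
            (sum_level_le hA (s₀ := s₀) (w y) (H y) (fun i => ENNReal.ofReal (q i))
              (Finset.Ico j k) fun i hi h => hq i (Finset.mem_Ico.1 hi).1 y hy h)
          simp only [indicator, hE, mem_ofPred_eq]
      _ = (s₀ + 1 : ℕ) * ∫⁻ y in S, H y := lintegral_const_mul' _ _ (ENNReal.natCast_ne_top _)
      _ ≤ (s₀ + 1 : ℕ) * ENNReal.ofReal I := by gcongr
      _ = _ := by
          rw [ENNReal.ofReal_mul (by positivity), ← ENNReal.ofReal_natCast]
          push_cast
          rfl
  have hsum : ENNReal.ofReal (∑ i ∈ Finset.Ico j k, q i *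
      volume.real {y ∈ S | A i ≤ w y ∧ (w y : ℝ) < A (i + s₀ + 1)}) =
      ∑ i ∈ Finset.Ico j k, ENNReal.ofReal (q i) * volume.restrict S (E i) := by
    rw [ENNReal.ofReal_sum_of_nonneg fun i _ => mul_nonneg (hq0 i) measureReal_nonneg]
    refine Finset.sum_congr rfl fun i _ => ?_
    rw [ENNReal.ofReal_mul (hq0 i), measureReal_def, hvol, ENNReal.ofReal_toReal (hfin i)]
  rw [← hsum, ENNReal.ofReal_le_ofReal_iff (by positivity)] at hmain
  exact hmain

/-- The constant of Domar's estimate in dimension `N`. -/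
def domarConst (N : ℕ) (K : ℝ) (s₀ : ℕ) : ℝ :=
  2 ^ N * (2 * K / unitBallVolume N * (s₀ + 1))

/-- Domar's estimate. If `w` reaches the level `A (j + s₀)` at the centre of a ball, then the
integral over the ball of a function `H` that is at least `q i` where `w ≥ A i` cannot be small.
Hölder's inequality is applied to the step lengths of Domar's chain. -/
lemma SubmeanOn.domar_estimate (hN : 2 ≤ N) {K : ℝ} (hK : 1 ≤ K)
    {w : EuclideanSpace ℝ (Fin N) → ℝ≥0}
    {a : EuclideanSpace ℝ (Fin N)} {δ : ℝ} (hδ : 0 < δ)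
    (hw : SubmeanOn K w (Metric.closedBall a δ))
    (hwm : AEMeasurable w (volume.restrict (Metric.closedBall a δ)))
    {M : ℝ} (hM : ∀ y ∈ Metric.closedBall a δ, (w y : ℝ) ≤ M)
    {A : ℕ → ℝ} (hApos : ∀ i, 0 < A i) (hAmono : StrictMono A)
    (hAtop : Filter.Tendsto A Filter.atTop Filter.atTop)
    {s₀ : ℕ} (hA : ∀ i, 2 * K * A i ≤ A (i + s₀)) {j : ℕ} (hj : A (j + s₀) ≤ w a)
    {q : ℕ → ℝ} (hq0 : ∀ i, 0 < q i) {H : EuclideanSpace ℝ (Fin N) → ℝ≥0∞}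
    (hq : ∀ i, j ≤ i → ∀ y ∈ Metric.closedBall a δ, A i ≤ w y → ENNReal.ofReal (q i) ≤ H y)
    {I : ℝ} (hI0 : 0 ≤ I) (hI : ∫⁻ y in Metric.closedBall a δ, H y ≤ ENNReal.ofReal I)
    {f : ℝ} (hf : ∀ k, ∑ i ∈ Finset.Ico j k,
      (A (i + s₀ + 1) / A (i + s₀) / q i) ^ (1 / ((N : ℝ) - 1)) ≤ f) :
    δ ^ N ≤ domarConst N K s₀ * I * f ^ ((N : ℝ) - 1) := by
  obtain ⟨k, hk⟩ := hw.exists_le_sum_radii (by omega) hK hδ hM hApos hAtop hA hj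
  have hlevel := sum_mul_volume_level_le Metric.isClosed_closedBall.measurableSet
    measure_closedBall_lt_top.ne hwm hAmono (s₀ := s₀) (fun i => (hq0 i).le) hq hI0 hI k
  have hν := unitBallVolume_pos N
  set e : ℕ → ℝ := fun i =>
    volume.real {y ∈ Metric.closedBall a δ | A i ≤ w y ∧ (w y : ℝ) < A (i + s₀ + 1)} with he
  have he0 : ∀ i, 0 ≤ e i := fun i => measureReal_nonneg
  set ρ : ℕ → ℝ := fun i => A (i + s₀ + 1) / A (i + s₀) with hρ
  have hρ0 : ∀ i, 0 < ρ i := fun i => div_pos (hApos _) (hApos _)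
  set c := 2 * K / unitBallVolume N with hc
  have hc0 : 0 < c := by positivity
  have hNR : (2 : ℝ) ≤ N := by exact_mod_cast hN
  have hN1 : (0 : ℝ) < (N : ℝ) - 1 := by linarith
  have hconj : Real.HolderConjugate (N : ℝ) ((N : ℝ) / ((N : ℝ) - 1)) :=
    Real.HolderConjugate.conjExponent (by linarith)
  -- The factors `q i` are inserted so that the first sum in Hölder's inequality is `∑ q i * e i`.
  have hterm : ∀ i, (c * (ρ i * e i)) ^ (1 / (N : ℝ)) =
      c ^ (1 / (N : ℝ)) * ((q i * e i) ^ (1 / (N : ℝ)) * (ρ i / q i) ^ (1 / (N : ℝ))) := by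
    intro i
    have := hq0 i
    have := hρ0 i
    have := he0 i
    rw [← Real.mul_rpow (by positivity) (by positivity), ← Real.mul_rpow (by positivity)
      (by positivity)]
    congr 1
    field_simp
  have hH := Real.inner_le_Lp_mul_Lq_of_nonneg (Finset.Ico j k) hconj
    (f := fun i => (q i * e i) ^ (1 / (N : ℝ))) (g := fun i => (ρ i / q i) ^ (1 / (N : ℝ)))
    (fun i _ => Real.rpow_nonneg (mul_nonneg (hq0 i).le (he0 i)) _)
    (fun i _ => Real.rpow_nonneg (div_nonneg (hρ0 i).le (hq0 i).le) _)
  have e1 : ∀ i, ((q i * e i) ^ (1 / (N : ℝ))) ^ (N : ℝ) = q i * e i := by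
    intro i
    rw [← Real.rpow_mul (mul_nonneg (hq0 i).le (he0 i)), one_div_mul_cancel (by linarith),
      Real.rpow_one]
  have e2 : ∀ i, ((ρ i / q i) ^ (1 / (N : ℝ))) ^ ((N : ℝ) / ((N : ℝ) - 1)) =
      (ρ i / q i) ^ (1 / ((N : ℝ) - 1)) := by
    intro i
    rw [← Real.rpow_mul (div_nonneg (hρ0 i).le (hq0 i).le)]
    congr 1
    field_simp
  simp only [e1, e2] at hH
  have hsum0 : 0 ≤ ∑ i ∈ Finset.Ico j k, q i * e i :=
    Finset.sum_nonneg fun i _ => mul_nonneg (hq0 i).le (he0 i)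
  have hsum0' : 0 ≤ ∑ i ∈ Finset.Ico j k, (ρ i / q i) ^ (1 / ((N : ℝ) - 1)) :=
    Finset.sum_nonneg fun i _ => Real.rpow_nonneg (div_nonneg (hρ0 i).le (hq0 i).le) _
  have hf0 : 0 ≤ f := hsum0'.trans (hf k)
  have hbound : δ / 2 ≤ c ^ (1 / (N : ℝ)) * (((s₀ + 1) * I) ^ (1 / (N : ℝ)) *
      f ^ (1 / ((N : ℝ) / ((N : ℝ) - 1)))) := by
    refine hk.trans ?_
    rw [Finset.sum_congr rfl fun i _ => hterm i, ← Finset.mul_sum]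
    refine mul_le_mul_of_nonneg_left (hH.trans ?_) (Real.rpow_nonneg hc0.le _)
    have := hf k
    have : 0 ≤ 1 / ((N : ℝ) / ((N : ℝ) - 1)) := by positivity
    gcongr
  have hpow := pow_le_pow_left₀ (by positivity) hbound N
  have hNne : N ≠ 0 := by omega
  have e3 : (f ^ (1 / ((N : ℝ) / ((N : ℝ) - 1)))) ^ N = f ^ ((N : ℝ) - 1) := by
    rw [← Real.rpow_natCast, ← Real.rpow_mul hf0]
    congr 1
    field_simp
  rw [mul_pow, mul_pow, e3, one_div, Real.rpow_inv_natCast_pow hc0.le hNne,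
    Real.rpow_inv_natCast_pow (by positivity) hNne, div_pow, div_le_iff₀ (by positivity)] at hpow
  refine hpow.trans (le_of_eq ?_)
  rw [domarConst]
  ring

/-- The mean value inequality over balls of a fixed radius bounds `w` near the centre. -/
lemma SubmeanOn.exists_bound {K : ℝ} {w : EuclideanSpace ℝ (Fin N) → ℝ≥0}
    {a : EuclideanSpace ℝ (Fin N)} {δ : ℝ} (hδ : 0 < δ)
    (hw : SubmeanOn K w (Metric.closedBall a (2 * δ)))
    (hint : ∫⁻ y in Metric.closedBall a (2 * δ), (w y : ℝ≥0∞) ≠ ⊤) :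
    ∃ M : ℝ, ∀ y ∈ Metric.closedBall a δ, (w y : ℝ) ≤ M := by
  set B := ENNReal.ofReal K * ((∫⁻ y in Metric.closedBall a (2 * δ), (w y : ℝ≥0∞)) /
    ENNReal.ofReal (δ ^ N * unitBallVolume N)) with hB
  have hν := unitBallVolume_pos N
  have hBtop : B ≠ ⊤ := by
    refine ENNReal.mul_ne_top ENNReal.ofReal_ne_top (ENNReal.div_ne_top hint ?_)
    rw [Ne, ENNReal.ofReal_eq_zero, not_le]
    positivity
  refine ⟨B.toReal, fun y hy => ?_⟩
  have hsub : Metric.closedBall y δ ⊆ Metric.closedBall a (2 * δ) :=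
    Metric.closedBall_subset_closedBall' (by linarith [Metric.mem_closedBall.1 hy])
  have h := hw y δ hδ hsub
  rw [setLAverage_eq, volume_ball_eq y hδ] at h
  have h2 : (w y : ℝ≥0∞) ≤ B := by
    refine h.trans ?_
    rw [hB]
    gcongr
    exact Metric.ball_subset_closedBall.trans hsub
  simpa using ENNReal.toReal_mono hBtop h2

/-! ### The levels `ϕ⁻¹(e^s)` and the series they generate -/

lemma invExp_pos (ϕ : ℝ≥0 ≃o ℝ≥0) (s : ℝ) : 0 < invExp ϕ s := by
  have h : ϕ.symm 0 < ϕ.symm (Real.exp s).toNNReal :=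
    ϕ.symm.strictMono (Real.toNNReal_pos.2 (Real.exp_pos s))
  exact_mod_cast (zero_le (a := ϕ.symm 0)).trans_lt h

lemma invExp_strictMono (ϕ : ℝ≥0 ≃o ℝ≥0) : StrictMono (invExp ϕ) := by
  intro s t hst
  refine NNReal.coe_lt_coe.2 (ϕ.symm.strictMono ?_)
  exact (Real.toNNReal_lt_toNNReal_iff (Real.exp_pos t)).2 (Real.exp_lt_exp.2 hst)

lemma continuous_invExp (ϕ : ℝ≥0 ≃o ℝ≥0) : Continuous (invExp ϕ) :=
  NNReal.continuous_coe.comp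
    (ϕ.symm.continuous.comp (continuous_real_toNNReal.comp Real.continuous_exp))

lemma tendsto_invExp_atTop (ϕ : ℝ≥0 ≃o ℝ≥0) :
    Filter.Tendsto (invExp ϕ) Filter.atTop Filter.atTop :=
  NNReal.tendsto_coe_atTop.2 (ϕ.symm.tendsto_atTop.comp
    (Real.tendsto_toNNReal_atTop.comp Real.tendsto_exp_atTop))

lemma le_logPlus_of_invExp_le (ϕ : ℝ≥0 ≃o ℝ≥0) {s : ℝ} {t : ℝ≥0} (h : invExp ϕ s ≤ t) :
    s ≤ logPlus ϕ t := by
  have h1 : ϕ.symm (Real.exp s).toNNReal ≤ t := NNReal.coe_le_coe.1 h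
  have h2 : (Real.exp s).toNNReal ≤ ϕ t := ϕ.symm_apply_le.1 h1
  have h3 : Real.exp s ≤ ϕ t := Real.toNNReal_le_iff_le_coe.1 h2
  calc s = Real.log (Real.exp s) := (Real.log_exp s).symm
    _ ≤ Real.log (ϕ t) := Real.log_le_log (Real.exp_pos s) h3
    _ ≤ Real.posLog (ϕ t) := le_max_right _ _

lemma orderIso_pos (φ : ℝ≥0 ≃o ℝ≥0) {t : ℝ≥0} (ht : 0 < t) : (0 : ℝ) < φ t := by
  have h : φ 0 < φ t := φ.strictMono ht
  exact_mod_cast (zero_le (a := φ 0)).trans_lt h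

lemma sum_range_le_integral {h : ℝ → ℝ} {c : ℝ} {a : ℕ → ℝ} (n : ℕ)
    (hint : ∀ i : ℕ, IntervalIntegrable h volume (c + i) (c + (i + 1 : ℕ)))
    (ha : ∀ i : ℕ, i < n → ∀ t ∈ Icc (c + i) (c + (i + 1 : ℕ)), a i ≤ h t) :
    ∑ i ∈ Finset.range n, a i ≤ ∫ t in c..(c + n), h t := by
  have hsum := intervalIntegral.sum_integral_adjacent_intervals (a := fun i : ℕ => c + (i : ℝ))
    (n := n) fun i _ => hint i
  simp only [Nat.cast_zero, add_zero] at hsum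
  rw [← hsum]
  refine Finset.sum_le_sum fun i hi => ?_
  have hle : c + (i : ℝ) ≤ c + (i + 1 : ℕ) := by push_cast; linarith
  have h1 := intervalIntegral.integral_mono_on hle (f := fun _ => a i)
    intervalIntegrable_const (hint i) (ha i (Finset.mem_range.1 hi))
  rw [intervalIntegral.integral_const] at h1
  push_cast at h1 ⊢
  simpa using h1

/-- The level `ϕ⁻¹(e^(b + i))`. -/
def level (ϕ : ℝ≥0 ≃o ℝ≥0) (b i : ℕ) : ℝ := invExp ϕ ((b : ℝ) + i)

lemma level_pos (ϕ : ℝ≥0 ≃o ℝ≥0) (b i : ℕ) : 0 < level ϕ b i := invExp_pos _ _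

lemma level_strictMono (ϕ : ℝ≥0 ≃o ℝ≥0) (b : ℕ) : StrictMono (level ϕ b) := fun i j hij =>
  invExp_strictMono ϕ (by simpa using hij)

lemma tendsto_level_atTop (ϕ : ℝ≥0 ≃o ℝ≥0) (b : ℕ) :
    Filter.Tendsto (level ϕ b) Filter.atTop Filter.atTop :=
  (tendsto_invExp_atTop ϕ).comp
    (Filter.tendsto_atTop_add_const_left _ _ tendsto_natCast_atTop_atTop)

/-- The weight that Domar's estimate in `ℝ^m` attaches to the `l`-th level: the ratio of consecutive
levels at `l + s₀`, where the chain stands, divided by the value that `φ ∘ log⁺ ∘ ϕ` takes at the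
lower level `l`. -/
def innerWeight (m : ℕ) (φ ϕ : ℝ≥0 ≃o ℝ≥0) (s₀ b l : ℕ) : ℝ :=
  (level ϕ b (l + s₀ + 1) / level ϕ b (l + s₀) / (φ (b + l : ℕ) : ℝ)) ^ (1 / ((m : ℝ) - 1))

/-- The part of the weight in Domar's estimate in `ℝ^n` that comes from the ratio of consecutive
levels. The shift by `2 s₀` arises because the lower level there, `l + s₀`, is the level at which
the estimate in `ℝ^m` starts. -/
def outerWeight (n : ℕ) (ϕ : ℝ≥0 ≃o ℝ≥0) (s₀ b l : ℕ) : ℝ :=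
  (level ϕ b (l + s₀ + s₀ + 1) / level ϕ b (l + s₀ + s₀)) ^ (1 / ((n : ℝ) - 1))

lemma innerWeight_pos {m : ℕ} (φ ϕ : ℝ≥0 ≃o ℝ≥0) (s₀ : ℕ) {b : ℕ} (hb : 0 < b) (l : ℕ) :
    0 < innerWeight m φ ϕ s₀ b l :=
  Real.rpow_pos_of_pos (div_pos (div_pos (level_pos _ _ _) (level_pos _ _ _))
    (orderIso_pos φ (by positivity))) _

lemma outerWeight_pos {n : ℕ} (ϕ : ℝ≥0 ≃o ℝ≥0) (s₀ b l : ℕ) : 0 < outerWeight n ϕ s₀ b l :=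
  Real.rpow_pos_of_pos (div_pos (level_pos _ _ _) (level_pos _ _ _)) _

lemma one_le_outerWeight {n : ℕ} (hn : 2 ≤ n) (ϕ : ℝ≥0 ≃o ℝ≥0) (s₀ b l : ℕ) :
    1 ≤ outerWeight n ϕ s₀ b l := by
  have : (2 : ℝ) ≤ n := by exact_mod_cast hn
  refine Real.one_le_rpow ?_ (one_div_nonneg.2 (by linarith))
  rw [one_le_div (level_pos _ _ _)]
  exact (level_strictMono ϕ b).monotone (by omega)

/-- The integrand of the inner integral is continuous and positive, so its integral dominates the
partial sums of the outer weights. -/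
lemma sum_outerWeight_le {n : ℕ} (hn : 2 ≤ n) (ϕ : ℝ≥0 ≃o ℝ≥0) {s₀ b : ℕ} {α β : ℝ} (l : ℕ)
    (hα : α ≤ (b : ℝ) + s₀ + s₀ - 1) (hβ : (b : ℝ) + s₀ + s₀ + l ≤ β) :
    ∑ i ∈ Finset.range (l + 1), outerWeight n ϕ s₀ b i ≤
      ∫ t in α..β, (invExp ϕ (t + 2) / invExp ϕ t) ^ (1 / ((n : ℝ) - 1)) := by
  have hnR : (2 : ℝ) ≤ n := by exact_mod_cast hn
  have hexp : 0 ≤ 1 / ((n : ℝ) - 1) := one_div_nonneg.2 (by linarith)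
  set h : ℝ → ℝ := fun t => (invExp ϕ (t + 2) / invExp ϕ t) ^ (1 / ((n : ℝ) - 1)) with hh
  have hcont : Continuous h := by
    refine Continuous.rpow_const (Continuous.div ?_ (continuous_invExp ϕ)
      fun t => (invExp_pos ϕ t).ne') fun t => Or.inr hexp
    exact (continuous_invExp ϕ).comp (continuous_id.add continuous_const)
  have hnn : ∀ t, 0 ≤ h t := fun t =>
    Real.rpow_nonneg (div_nonneg (invExp_pos _ _).le (invExp_pos _ _).le) _
  have hsum := sum_range_le_integral (h := h) (c := (b : ℝ) + s₀ + s₀ - 1)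
    (a := outerWeight n ϕ s₀ b) (l + 1) (fun i => hcont.intervalIntegrable _ _)
    (by
      intro i _ t ht
      have ht2 := ht.2
      have ht1 := ht.1
      push_cast at ht2
      refine Real.rpow_le_rpow (div_nonneg (level_pos _ _ _).le (level_pos _ _ _).le) ?_ hexp
      refine div_le_div₀ (invExp_pos _ _).le ?_ (invExp_pos _ _) ?_
      · refine (invExp_strictMono ϕ).monotone ?_
        push_cast; linarith
      · refine (invExp_strictMono ϕ).monotone ?_
        push_cast; linarith)
  refine hsum.trans ?_
  refine intervalIntegral.integral_mono_interval hα ?_ ?_ (Filter.Eventually.of_forall hnn)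
    (hcont.intervalIntegrable _ _)
  · push_cast; linarith [(Nat.cast_nonneg l : (0 : ℝ) ≤ l)]
  · push_cast; linarith

/-- The double integral dominates the series of the weights. -/
lemma summable_innerWeight_mul {m n : ℕ} (hn : 2 ≤ n) (hmn : n ≤ m) (φ ϕ : ℝ≥0 ≃o ℝ≥0)
    {s₀ s₁ b : ℕ} (hb : sFive ϕ s₀ s₁ + 3 ≤ b)
    (hint : IntegrableOn (integrand m n φ ϕ s₀ s₁) (Ici (sFive ϕ s₀ s₁)) volume) :
    Summable fun l => innerWeight m φ ϕ s₀ b l *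
      (∑ i ∈ Finset.range (l + 1), outerWeight n ϕ s₀ b i) ^ (((n : ℝ) - 1) / ((m : ℝ) - 1)) := by
  have hnR : (2 : ℝ) ≤ n := by exact_mod_cast hn
  have hmnR : (n : ℝ) ≤ m := by exact_mod_cast hmn
  set σ := sFive ϕ s₀ s₁ with hσ
  have hσ3 : (s₀ : ℝ) + 3 ≤ σ := by
    refine le_trans ?_ (le_max_left _ _)
    linarith [(Nat.cast_nonneg s₁ : (0 : ℝ) ≤ s₁)]
  have hs0 : (0 : ℝ) ≤ s₀ := Nat.cast_nonneg _
  have hb0 : 0 < b := by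
    have : (0 : ℝ) < b := by linarith
    exact_mod_cast this
  have hexp : 0 ≤ 1 / ((m : ℝ) - 1) := one_div_nonneg.2 (by linarith)
  have hexp' : 0 ≤ ((n : ℝ) - 1) / ((m : ℝ) - 1) := div_nonneg (by linarith) (by linarith)
  set c : ℝ := (b : ℝ) + s₀ - 1 with hc
  have hσc : σ ≤ c := by rw [hc]; linarith
  have hnonneg : ∀ s ∈ Ici σ, 0 ≤ integrand m n φ ϕ s₀ s₁ s := by
    intro s hs
    have hs' : σ ≤ s := hs
    refine mul_nonneg (Real.rpow_nonneg (mul_nonneg (div_nonneg (invExp_pos _ _).le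
      (invExp_pos _ _).le) (by positivity)) _) (Real.rpow_nonneg ?_ _)
    refine intervalIntegral.integral_nonneg (by linarith) fun t _ =>
      Real.rpow_nonneg (div_nonneg (invExp_pos _ _).le (invExp_pos _ _).le) _
  have hsum0 : ∀ l, 0 ≤ ∑ i ∈ Finset.range (l + 1), outerWeight n ϕ s₀ b i :=
    fun l => Finset.sum_nonneg fun i _ => (outerWeight_pos ϕ s₀ b i).le
  refine summable_of_sum_range_le (c := ∫ s in Ici σ, integrand m n φ ϕ s₀ s₁ s)
    (fun l => mul_nonneg (innerWeight_pos φ ϕ s₀ hb0 l).le (Real.rpow_nonneg (hsum0 l) _))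
    fun k => ?_
  have hii : ∀ x y, c ≤ x → x ≤ y →
      IntervalIntegrable (integrand m n φ ϕ s₀ s₁) volume x y := by
    intro x y hx hxy
    rw [intervalIntegrable_iff_integrableOn_Ioc_of_le hxy]
    exact hint.mono_set fun s hs => (hσc.trans hx).trans hs.1.le
  refine (sum_range_le_integral (h := integrand m n φ ϕ s₀ s₁) (c := c) k (fun i => hii _ _ ?_ ?_)
    ?_).trans ?_
  · linarith [(Nat.cast_nonneg i : (0 : ℝ) ≤ i)]
  · push_cast; linarith
  · intro l _ s hs
    have hs1 := hs.1
    have hs2 := hs.2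
    push_cast at hs2
    have hl0 : (0 : ℝ) ≤ l := Nat.cast_nonneg _
    have hφpos : (0 : ℝ) < φ (s - s₀).toNNReal :=
      orderIso_pos φ (Real.toNNReal_pos.2 (by linarith))
    refine mul_le_mul ?_ ?_ (Real.rpow_nonneg (hsum0 l) _) (Real.rpow_nonneg
      (mul_nonneg (div_nonneg (invExp_pos _ _).le (invExp_pos _ _).le) (by positivity)) _)
    · refine Real.rpow_le_rpow (div_nonneg (div_nonneg (level_pos _ _ _).le (level_pos _ _ _).le)
        (NNReal.coe_nonneg _)) ?_ hexp
      rw [mul_one_div]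
      refine div_le_div₀ (div_nonneg (invExp_pos _ _).le (invExp_pos _ _).le)
        (div_le_div₀ (invExp_pos _ _).le ?_ (invExp_pos _ _) ?_) hφpos ?_
      · refine (invExp_strictMono ϕ).monotone ?_
        push_cast; linarith
      · refine (invExp_strictMono ϕ).monotone ?_
        push_cast; linarith
      · refine NNReal.coe_le_coe.2 (φ.monotone ?_)
        rw [Real.toNNReal_le_iff_le_coe]
        push_cast; linarith
    · refine Real.rpow_le_rpow (hsum0 l) (sum_outerWeight_le hn ϕ l ?_ ?_) hexp'
      · linarith
      · linarith
  · rw [intervalIntegral.integral_of_le (by linarith [(Nat.cast_nonneg k : (0 : ℝ) ≤ k)])]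
    refine setIntegral_mono_set hint ?_ ?_
    · exact (ae_restrict_iff' measurableSet_Ici).2 (Filter.Eventually.of_forall hnonneg)
    · exact Filter.Eventually.of_forall fun s hs => hσc.trans hs.1.le

lemma summable_innerWeight {m n : ℕ} (hn : 2 ≤ n) (hmn : n ≤ m) (φ ϕ : ℝ≥0 ≃o ℝ≥0)
    {s₀ b : ℕ} (hb : 0 < b)
    (h : Summable fun l => innerWeight m φ ϕ s₀ b l *
      (∑ i ∈ Finset.range (l + 1), outerWeight n ϕ s₀ b i) ^ (((n : ℝ) - 1) / ((m : ℝ) - 1))) :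
    Summable (innerWeight m φ ϕ s₀ b) := by
  have hnR : (2 : ℝ) ≤ n := by exact_mod_cast hn
  have hmnR : (n : ℝ) ≤ m := by exact_mod_cast hmn
  refine Summable.of_nonneg_of_le (fun l => (innerWeight_pos φ ϕ s₀ hb l).le) (fun l => ?_) h
  refine le_mul_of_one_le_right (innerWeight_pos φ ϕ s₀ hb l).le
    (Real.one_le_rpow ?_ (div_nonneg (by linarith) (by linarith)))
  refine (one_le_outerWeight hn ϕ s₀ b 0).trans ?_
  exact Finset.single_le_sum (f := outerWeight n ϕ s₀ b)
    (fun i _ => (outerWeight_pos ϕ s₀ b i).le) (by simp)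

/-! ### Local boundedness of separately submean functions -/

lemma SubmeanOn.mono {N : ℕ} {K : ℝ} {w : EuclideanSpace ℝ (Fin N) → ℝ≥0}
    {D S : Set (EuclideanSpace ℝ (Fin N))} (hw : SubmeanOn K w D) (hS : S ⊆ D) :
    SubmeanOn K w S := fun x r hr hx => hw x r hr (hx.trans hS)

lemma tendsto_tailSum (g : ℕ → ℝ) :
    Filter.Tendsto (tailSum g) Filter.atTop (nhds 0) := by
  refine ((tendsto_tsum_compl_atTop_zero g).comp Filter.tendsto_finset_range).congr fun l => ?_
  simp only [Function.comp_apply, tailSum]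
  have h := tsum_subtype {x | x ∉ Finset.range l} g
  refine h.trans (tsum_congr fun i => ?_)
  have : {x | x ∉ Finset.range l} = Ici l := by
    ext i; simp
  rw [this]

lemma domarConst_pos (N : ℕ) {K : ℝ} (hK : 1 ≤ K) (s₀ : ℕ) : 0 < domarConst N K s₀ := by
  have := unitBallVolume_pos N
  unfold domarConst
  positivity

/-- Domar's estimate, applied first in `ℝ^m` and then in `ℝ^n`. In the first step the integrals
`F y = ∫ H x y dx` are bounded from below at those `y` for which `v x y` is large; in the second
step `F` takes the role of the function `H`. -/
theorem exists_bound_of_separately_submean {m n : ℕ} (hn : 2 ≤ n) (hmn : n ≤ m) {K : ℝ}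
    (hK : 1 ≤ K) {v : EuclideanSpace ℝ (Fin m) → EuclideanSpace ℝ (Fin n) → ℝ≥0}
    {x₀ : EuclideanSpace ℝ (Fin m)} {y₀ : EuclideanSpace ℝ (Fin n)} {δ : ℝ} (hδ : 0 < δ)
    (hx : ∀ y ∈ Metric.closedBall y₀ (3 * δ),
      SubmeanOn K (fun x => v x y) (Metric.closedBall x₀ (3 * δ)))
    (hxm : ∀ y ∈ Metric.closedBall y₀ (3 * δ),
      AEMeasurable (fun x => v x y) (volume.restrict (Metric.closedBall x₀ (3 * δ))))
    (hxi : ∀ y ∈ Metric.closedBall y₀ (3 * δ),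
      ∫⁻ x in Metric.closedBall x₀ (3 * δ), (v x y : ℝ≥0∞) ≠ ⊤)
    (hy : ∀ x ∈ Metric.closedBall x₀ (3 * δ),
      SubmeanOn K (fun y => v x y) (Metric.closedBall y₀ (3 * δ)))
    (hym : ∀ x ∈ Metric.closedBall x₀ (3 * δ),
      AEMeasurable (fun y => v x y) (volume.restrict (Metric.closedBall y₀ (3 * δ))))
    (hyi : ∀ x ∈ Metric.closedBall x₀ (3 * δ),
      ∫⁻ y in Metric.closedBall y₀ (3 * δ), (v x y : ℝ≥0∞) ≠ ⊤)
    {H : EuclideanSpace ℝ (Fin m) → EuclideanSpace ℝ (Fin n) → ℝ≥0∞}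
    (hH : ∫⁻ y in Metric.closedBall y₀ (2 * δ), ∫⁻ x in Metric.closedBall x₀ (2 * δ), H x y ≠ ⊤)
    {A : ℕ → ℝ} (hApos : ∀ i, 0 < A i) (hAmono : StrictMono A)
    (hAtop : Filter.Tendsto A Filter.atTop Filter.atTop)
    {s₀ : ℕ} (hA : ∀ i, 2 * K * A i ≤ A (i + s₀))
    {q : ℕ → ℝ} (hq0 : ∀ i, 0 < q i) (hq : ∀ i x y, A i ≤ v x y → ENNReal.ofReal (q i) ≤ H x y)
    {g w : ℕ → ℝ}
    (hg : ∀ i, g i = (A (i + s₀ + 1) / A (i + s₀) / q i) ^ (1 / ((m : ℝ) - 1)))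
    (hw : ∀ i, w i = (A (i + s₀ + s₀ + 1) / A (i + s₀ + s₀)) ^ (1 / ((n : ℝ) - 1)))
    (hgs : Summable g)
    (hs : Summable fun l => w l * tailSum g l ^ (((m : ℝ) - 1) / ((n : ℝ) - 1))) :
    ∃ M : ℝ, ∀ x ∈ Metric.closedBall x₀ δ, ∀ y ∈ Metric.closedBall y₀ δ, (v x y : ℝ) ≤ M := by
  have hnR : (2 : ℝ) ≤ n := by exact_mod_cast hn
  have hmnR : (n : ℝ) ≤ m := by exact_mod_cast hmn
  have hn1 : (0 : ℝ) < (n : ℝ) - 1 := by linarith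
  have hgpos : ∀ i, 0 < g i := fun i => by
    rw [hg]
    exact Real.rpow_pos_of_pos (div_pos (div_pos (hApos _) (hApos _)) (hq0 i)) _
  have hwpos : ∀ i, 0 < w i := fun i => by
    rw [hw]
    exact Real.rpow_pos_of_pos (div_pos (hApos _) (hApos _)) _
  have hfpos := tailSum_pos hgpos hgs
  set C₁ := domarConst m K s₀ with hC₁
  set C₂ := domarConst n K s₀ with hC₂
  have hC₁pos : 0 < C₁ := domarConst_pos m hK s₀
  have hC₂pos : 0 < C₂ := domarConst_pos n hK s₀
  set F : EuclideanSpace ℝ (Fin n) → ℝ≥0∞ :=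
    fun y => ∫⁻ x in Metric.closedBall x₀ (2 * δ), H x y with hF
  set q' : ℕ → ℝ := fun l => δ ^ m / (C₁ * tailSum g l ^ ((m : ℝ) - 1)) with hq'
  have hq'pos : ∀ l, 0 < q' l := fun l =>
    div_pos (pow_pos hδ m) (mul_pos hC₁pos (Real.rpow_pos_of_pos (hfpos l) _))
  have hball : ∀ {N : ℕ} {z z₀ : EuclideanSpace ℝ (Fin N)}, z ∈ Metric.closedBall z₀ δ →
      Metric.closedBall z (2 * δ) ⊆ Metric.closedBall z₀ (3 * δ) := fun hz =>
    Metric.closedBall_subset_closedBall' (by linarith [Metric.mem_closedBall.1 hz])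
  have hball' : ∀ {N : ℕ} {z z₀ : EuclideanSpace ℝ (Fin N)}, z ∈ Metric.closedBall z₀ δ →
      Metric.closedBall z δ ⊆ Metric.closedBall z₀ (2 * δ) := fun hz =>
    Metric.closedBall_subset_closedBall' (by linarith [Metric.mem_closedBall.1 hz])
  have h13 : ∀ {N : ℕ} {z : EuclideanSpace ℝ (Fin N)},
      Metric.closedBall z δ ⊆ Metric.closedBall z (2 * δ) :=
    fun hz => Metric.closedBall_subset_closedBall (by linarith) hz
  have h23 : ∀ {N : ℕ} {z : EuclideanSpace ℝ (Fin N)},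
      Metric.closedBall z (2 * δ) ⊆ Metric.closedBall z (3 * δ) :=
    fun hz => Metric.closedBall_subset_closedBall (by linarith) hz
  have hstep : ∀ x ∈ Metric.closedBall x₀ δ, ∀ y ∈ Metric.closedBall y₀ (2 * δ), ∀ j,
      A (j + s₀) ≤ v x y → ENNReal.ofReal (q' j) ≤ F y := by
    intro x hxx y hyy j hj
    by_cases htop : F y = ⊤
    · rw [htop]; exact le_top
    have hy3 := h23 hyy
    have hsub := hball hxx
    obtain ⟨M, hM⟩ := ((hx y hy3).mono hsub).exists_bound hδ
      (ne_top_of_le_ne_top (hxi y hy3) (lintegral_mono_set hsub))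
    have hI : ∫⁻ z in Metric.closedBall x δ, H z y ≤ ENNReal.ofReal (F y).toReal := by
      rw [ENNReal.ofReal_toReal htop]
      exact lintegral_mono_set (hball' hxx)
    have hest := ((hx y hy3).mono (h13.trans hsub)).domar_estimate (hn.trans hmn) hK hδ
      ((hxm y hy3).mono_measure (Measure.restrict_mono (h13.trans hsub) le_rfl)) hM hApos hAmono
      hAtop hA hj hq0 (H := fun z => H z y) (fun i _ z _ h => hq i z y h) ENNReal.toReal_nonneg hI
      (f := tailSum g j) (fun k => by
        simp_rw [← hg]
        exact sum_Ico_le_tailSum (fun i => (hgpos i).le) hgs j k)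
    rw [← ENNReal.ofReal_toReal htop]
    refine ENNReal.ofReal_le_ofReal ?_
    rw [hq', div_le_iff₀ (mul_pos hC₁pos (Real.rpow_pos_of_pos (hfpos j) _))]
    refine hest.trans (le_of_eq ?_)
    ring
  set I := (∫⁻ y in Metric.closedBall y₀ (2 * δ), F y).toReal with hIdef
  set h : ℕ → ℝ := fun l => w l * tailSum g l ^ (((m : ℝ) - 1) / ((n : ℝ) - 1)) with hh
  have hhnn : ∀ l, 0 ≤ h l := fun l =>
    mul_nonneg (hwpos l).le (Real.rpow_nonneg (hfpos l).le _)
  set κ := (C₁ / δ ^ m) ^ (1 / ((n : ℝ) - 1)) with hκ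
  obtain ⟨l₀, hl₀⟩ : ∃ l₀, C₂ * I * (κ * tailSum h l₀) ^ ((n : ℝ) - 1) < δ ^ n := by
    have ht : Filter.Tendsto (fun l => C₂ * I * (κ * tailSum h l) ^ ((n : ℝ) - 1)) Filter.atTop
        (nhds (C₂ * I * (κ * 0) ^ ((n : ℝ) - 1))) :=
      (((tendsto_tailSum h).const_mul κ).rpow_const (Or.inr hn1.le)).const_mul _
    rw [mul_zero, Real.zero_rpow hn1.ne', mul_zero] at ht
    exact (ht.eventually_lt_const (pow_pos hδ n)).exists
  refine ⟨A (l₀ + s₀ + s₀), fun x hxx y hyy => ?_⟩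
  by_contra! hlt
  have hx3 : x ∈ Metric.closedBall x₀ (3 * δ) := h23 (h13 hxx)
  have hsub := hball hyy
  obtain ⟨M, hM⟩ := ((hy x hx3).mono hsub).exists_bound hδ
    (ne_top_of_le_ne_top (hyi x hx3) (lintegral_mono_set hsub))
  have hI : ∫⁻ z in Metric.closedBall y δ, F z ≤ ENNReal.ofReal I := by
    rw [hIdef, ENNReal.ofReal_toReal hH]
    exact lintegral_mono_set (hball' hyy)
  have hsum : ∀ k, ∑ i ∈ Finset.Ico l₀ k, (A (i + s₀ + 1 + s₀) / A (i + s₀ + s₀) / q' i) ^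
      (1 / ((n : ℝ) - 1)) ≤ κ * tailSum h l₀ := by
    intro k
    have hterm : ∀ i, (A (i + s₀ + 1 + s₀) / A (i + s₀ + s₀) / q' i) ^ (1 / ((n : ℝ) - 1)) =
        κ * h i := by
      intro i
      have hρ : 0 ≤ A (i + s₀ + s₀ + 1) / A (i + s₀ + s₀) := (div_pos (hApos _) (hApos _)).le
      have hpw : 0 ≤ tailSum g i ^ ((m : ℝ) - 1) := Real.rpow_nonneg (hfpos i).le _
      have e : A (i + s₀ + 1 + s₀) / A (i + s₀ + s₀) / q' i =
          C₁ / δ ^ m * (A (i + s₀ + s₀ + 1) / A (i + s₀ + s₀) * tailSum g i ^ ((m : ℝ) - 1)) := by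
        rw [show i + s₀ + 1 + s₀ = i + s₀ + s₀ + 1 by ring]
        simp only [hq']
        field_simp
      rw [e, Real.mul_rpow (by positivity) (by positivity), Real.mul_rpow hρ hpw,
        ← Real.rpow_mul (hfpos i).le, mul_one_div]
      simp only [hh, hκ, hw]
    rw [Finset.sum_congr rfl fun i _ => hterm i, ← Finset.mul_sum]
    exact mul_le_mul_of_nonneg_left (sum_Ico_le_tailSum hhnn hs l₀ k) (by positivity)
  have hest := ((hy x hx3).mono (h13.trans hsub)).domar_estimate hn hK hδ
    ((hym x hx3).mono_measure (Measure.restrict_mono (h13.trans hsub) le_rfl)) hM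
    (A := fun i => A (i + s₀)) (fun i => hApos _) (fun i j hij => hAmono (by omega))
    (hAtop.comp (Filter.tendsto_add_atTop_nat s₀)) (fun i => hA _) hlt.le hq'pos (H := F)
    (fun i _ z hz h => hstep x hxx z (hball' hyy hz) i h) ENNReal.toReal_nonneg hI hsum
  linarith

/-! ### The identification of `ℝ^m × ℝ^n` with `ℝ^(m+n)` -/

variable {m n : ℕ}

/-- The isometry behind `pair`, with the Euclidean norm on the product. -/
def pairIsometry (m n : ℕ) :
    EuclideanSpace ℝ (Fin (m + n)) ≃ₗᵢ[ℝ]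
      WithLp 2 (EuclideanSpace ℝ (Fin m) × EuclideanSpace ℝ (Fin n)) :=
  (LinearIsometryEquiv.piLpCongrLeft 2 ℝ ℝ finSumFinEquiv.symm).trans
    (PiLp.sumPiLpEquivProdLpPiLp 2 _)

lemma pair_eq (x : EuclideanSpace ℝ (Fin m)) (y : EuclideanSpace ℝ (Fin n)) :
    pair x y = (pairIsometry m n).symm (WithLp.toLp 2 (x, y)) := rfl

lemma measurePreserving_pair :
    MeasurePreserving (fun p : EuclideanSpace ℝ (Fin m) × EuclideanSpace ℝ (Fin n) =>
      pair p.1 p.2) :=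
  (pairIsometry m n).symm.measurePreserving.comp (WithLp.volume_preserving_toLp _ _)

lemma measurableEmbedding_pair :
    MeasurableEmbedding (fun p : EuclideanSpace ℝ (Fin m) × EuclideanSpace ℝ (Fin n) =>
      pair p.1 p.2) :=
  (EuclideanSpace.finAddEquivProd (𝕜 := ℝ) (n := m) (m := n)).symm.toHomeomorph.measurableEmbedding

lemma dist_pair_le (x x' : EuclideanSpace ℝ (Fin m)) (y y' : EuclideanSpace ℝ (Fin n)) :
    dist (pair x y) (pair x' y') ≤ dist x x' + dist y y' := by
  rw [pair_eq, pair_eq, LinearIsometryEquiv.dist_map, WithLp.prod_dist_eq_of_L2]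
  refine Real.sqrt_le_iff.2 ⟨by positivity, ?_⟩
  have h : 0 ≤ dist x x' * dist y y' := by positivity
  simp only [WithLp.toLp_fst, WithLp.toLp_snd]
  nlinarith

lemma aemeasurable_comp_pair {β : Type*} [MeasurableSpace β]
    {f : EuclideanSpace ℝ (Fin (m + n)) → β} {U : Set (EuclideanSpace ℝ (Fin (m + n)))}
    (hf : AEMeasurable f (volume.restrict U)) {S : Set (EuclideanSpace ℝ (Fin m))}
    {T : Set (EuclideanSpace ℝ (Fin n))} (hST : ∀ x ∈ S, ∀ y ∈ T, pair x y ∈ U) :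
    AEMeasurable (fun p : EuclideanSpace ℝ (Fin m) × EuclideanSpace ℝ (Fin n) => f (pair p.1 p.2))
      ((volume.restrict S).prod (volume.restrict T)) := by
  rw [Measure.prod_restrict]
  refine AEMeasurable.mono_measure ?_ (Measure.restrict_mono
    (show S ×ˢ T ⊆ (fun p => pair p.1 p.2) ⁻¹' U from fun p hp => hST _ hp.1 _ hp.2) le_rfl)
  exact hf.comp_quasiMeasurePreserving (measurePreserving_pair.restrict_preimage_emb
    measurableEmbedding_pair U).quasiMeasurePreserving

lemma lintegral_prod_pair_le (f : EuclideanSpace ℝ (Fin (m + n)) → ℝ≥0∞)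
    {U : Set (EuclideanSpace ℝ (Fin (m + n)))} {S : Set (EuclideanSpace ℝ (Fin m))}
    {T : Set (EuclideanSpace ℝ (Fin n))} (hST : ∀ x ∈ S, ∀ y ∈ T, pair x y ∈ U) :
    ∫⁻ p, f (pair p.1 p.2) ∂((volume.restrict S).prod (volume.restrict T)) ≤
      ∫⁻ z in U, f z := by
  rw [Measure.prod_restrict, ← measurePreserving_pair.setLIntegral_comp_preimage_emb
    measurableEmbedding_pair]
  exact lintegral_mono_set fun p hp => hST _ hp.1 _ hp.2

/-! ### Truncations of separately quasinearly subharmonic functions -/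

lemma measurable_plus : Measurable plus :=
  ENNReal.measurable_toNNReal.comp measurable_ereal_toENNReal

lemma measurable_truncate (M : ℝ) : Measurable (truncate M) :=
  measurable_ereal_toENNReal.comp
    ((measurable_id.max measurable_const).add measurable_const)

lemma truncate_zero {a : EReal} (ha : a < ⊤) : truncate 0 a = plus a := by
  rw [plus, ENNReal.coe_toNNReal (EReal.toENNReal_ne_top_iff.2 ha.ne), truncate]
  simp only [neg_zero, EReal.coe_zero, add_zero]
  rcases le_total a 0 with h | h
  · rw [max_eq_right h, EReal.toENNReal_of_nonpos h, EReal.toENNReal_zero]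
  · rw [max_eq_left h]

lemma IsKQuasinearlySubharmonicOn.submeanOn {N : ℕ} {K : ℝ}
    {u : EuclideanSpace ℝ (Fin N) → EReal} {D : Set (EuclideanSpace ℝ (Fin N))}
    (hu : IsKQuasinearlySubharmonicOn K u D) : SubmeanOn K (fun x => plus (u x)) D := by
  intro x r hr hx
  have h := hu.mean_value 0 le_rfl x r hr hx
  rw [truncate_zero (hu.lt_top x (hx (Metric.mem_closedBall_self hr.le)))] at h
  refine h.trans (le_of_eq ?_)
  rw [setLAverage_eq, setLAverage_eq]
  congr 2
  refine setLIntegral_congr_fun Metric.isOpen_ball.measurableSet fun y hy => ?_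
  exact truncate_zero (hu.lt_top y (hx (Metric.ball_subset_closedBall hy)))

lemma IsKQuasinearlySubharmonicOn.lintegral_plus_ne_top {N : ℕ} {K : ℝ}
    {u : EuclideanSpace ℝ (Fin N) → EReal} {D : Set (EuclideanSpace ℝ (Fin N))}
    (hu : IsKQuasinearlySubharmonicOn K u D) {a : EuclideanSpace ℝ (Fin N)} {r : ℝ}
    (hr : Metric.closedBall a r ⊆ D) :
    ∫⁻ x in Metric.closedBall a r, (plus (u x) : ℝ≥0∞) ≠ ⊤ := by
  have h : IntegrableOn (fun x => (plus (u x) : ℝ)) (Metric.closedBall a r) :=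
    hu.locallyIntegrable.mono_set hr |>.integrableOn_isCompact (isCompact_closedBall a r)
  simpa using h.lintegral_lt_top.ne

/-- The constant of the mean value inequality in `ℝ^(m+n)` obtained from products of balls. -/
def productConst (m n : ℕ) (K : ℝ) : ℝ :=
  K * K * 2 ^ (m + n) * unitBallVolume (m + n) / (unitBallVolume m * unitBallVolume n)

/-- Separate mean value inequalities give the joint one: the product of two balls of radius `r / 2`
lies in the ball of radius `r` and takes up a fixed proportion of it. -/
lemma truncate_le_of_separately {K : ℝ} (hK : 1 ≤ K) {Ω : Set (EuclideanSpace ℝ (Fin (m + n)))}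
    {u : EuclideanSpace ℝ (Fin (m + n)) → EReal} (hu_meas : AEMeasurable u (volume.restrict Ω))
    (ha : ∀ y : EuclideanSpace ℝ (Fin n), IsKQuasinearlySubharmonicOn K (fun x => u (pair x y))
        {x : EuclideanSpace ℝ (Fin m) | pair x y ∈ Ω})
    (hb : ∀ x : EuclideanSpace ℝ (Fin m), IsKQuasinearlySubharmonicOn K (fun y => u (pair x y))
        {y : EuclideanSpace ℝ (Fin n) | pair x y ∈ Ω})
    {M : ℝ} (hM : 0 ≤ M) (x₀ : EuclideanSpace ℝ (Fin m)) (y₀ : EuclideanSpace ℝ (Fin n)) {r : ℝ}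
    (hr : 0 < r) (hball : Metric.closedBall (pair x₀ y₀) r ⊆ Ω) :
    truncate M (u (pair x₀ y₀)) ≤ ENNReal.ofReal (productConst m n K) *
      ⨍⁻ z in Metric.ball (pair x₀ y₀) r, truncate M (u z) ∂volume := by
  have hr2 : 0 < r / 2 := by linarith
  have hK0 : 0 < K := by linarith
  have hdist : ∀ x ∈ Metric.closedBall x₀ (r / 2), ∀ y ∈ Metric.closedBall y₀ (r / 2),
      pair x y ∈ Metric.closedBall (pair x₀ y₀) r := by
    intro x hx y hy
    have := dist_pair_le x x₀ y y₀
    rw [Metric.mem_closedBall] at *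
    linarith
  have hdist' : ∀ x ∈ Metric.ball x₀ (r / 2), ∀ y ∈ Metric.ball y₀ (r / 2),
      pair x y ∈ Metric.ball (pair x₀ y₀) r := by
    intro x hx y hy
    have := dist_pair_le x x₀ y y₀
    rw [Metric.mem_ball] at *
    linarith
  set bm := (r / 2) ^ m * unitBallVolume m with hbm
  set bn := (r / 2) ^ n * unitBallVolume n with hbn
  set b := r ^ (m + n) * unitBallVolume (m + n) with hb'
  have hνm := unitBallVolume_pos m
  have hνn := unitBallVolume_pos n
  have hν := unitBallVolume_pos (m + n)
  have hbm0 : 0 < bm := by positivity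
  have hbn0 : 0 < bn := by positivity
  have hb0 : 0 < b := by positivity
  set f : EuclideanSpace ℝ (Fin (m + n)) → ℝ≥0∞ := fun z => truncate M (u z) with hf
  have hfm : AEMeasurable f (volume.restrict Ω) := (measurable_truncate M).comp_aemeasurable hu_meas
  have h1 : f (pair x₀ y₀) ≤ ENNReal.ofReal K *
      ((∫⁻ x in Metric.ball x₀ (r / 2), f (pair x y₀)) / ENNReal.ofReal bm) := by
    have h := (ha y₀).mean_value M hM x₀ (r / 2) hr2
      fun x hx => hball (hdist x hx y₀ (Metric.mem_closedBall_self hr2.le))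
    rwa [setLAverage_eq, volume_ball_eq _ hr2] at h
  have h2 : ∀ x ∈ Metric.ball x₀ (r / 2), f (pair x y₀) ≤ ENNReal.ofReal (K / bn) *
      ∫⁻ y in Metric.ball y₀ (r / 2), f (pair x y) := by
    intro x hx
    have h := (hb x).mean_value M hM y₀ (r / 2) hr2
      fun y hy => hball (hdist x (Metric.ball_subset_closedBall hx) y hy)
    rw [setLAverage_eq, volume_ball_eq _ hr2] at h
    refine h.trans (le_of_eq ?_)
    rw [← hbn, ENNReal.ofReal_div_of_pos hbn0, ENNReal.div_eq_inv_mul, ENNReal.div_eq_inv_mul]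
    ring
  have h3 : ∫⁻ x in Metric.ball x₀ (r / 2), f (pair x y₀) ≤ ENNReal.ofReal (K / bn) *
      ∫⁻ z in Metric.ball (pair x₀ y₀) r, f z := by
    calc ∫⁻ x in Metric.ball x₀ (r / 2), f (pair x y₀)
        ≤ ∫⁻ x in Metric.ball x₀ (r / 2), ENNReal.ofReal (K / bn) *
            ∫⁻ y in Metric.ball y₀ (r / 2), f (pair x y) :=
          setLIntegral_mono' Metric.isOpen_ball.measurableSet h2
      _ = ENNReal.ofReal (K / bn) * ∫⁻ x in Metric.ball x₀ (r / 2),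
            ∫⁻ y in Metric.ball y₀ (r / 2), f (pair x y) :=
          lintegral_const_mul' _ _ ENNReal.ofReal_ne_top
      _ ≤ _ := by
          refine mul_le_mul_right ?_ _
          rw [← lintegral_prod (fun p => f (pair p.1 p.2)) (aemeasurable_comp_pair hfm
            fun x hx y hy => hball (Metric.ball_subset_closedBall (hdist' x hx y hy)))]
          exact lintegral_prod_pair_le f hdist'
  refine h1.trans ?_
  rw [setLAverage_eq, volume_ball_eq _ hr]
  calc ENNReal.ofReal K *
      ((∫⁻ x in Metric.ball x₀ (r / 2), f (pair x y₀)) / ENNReal.ofReal bm)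
      ≤ ENNReal.ofReal K * ((ENNReal.ofReal (K / bn) *
        ∫⁻ z in Metric.ball (pair x₀ y₀) r, f z) / ENNReal.ofReal bm) := by gcongr
    _ = ENNReal.ofReal (K * (K / bn) * bm⁻¹) * ∫⁻ z in Metric.ball (pair x₀ y₀) r, f z := by
        rw [ENNReal.ofReal_mul (p := K * (K / bn)) (by positivity),
          ENNReal.ofReal_mul (p := K) hK0.le, ENNReal.ofReal_inv_of_pos hbm0, div_eq_mul_inv]
        ring
    _ = ENNReal.ofReal (productConst m n K * b⁻¹) *
        ∫⁻ z in Metric.ball (pair x₀ y₀) r, f z := by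
        congr 2
        simp only [productConst, hbm, hbn, hb', div_pow]
        field_simp
        ring
    _ = _ := by
        rw [ENNReal.ofReal_mul (by unfold productConst; positivity),
          ENNReal.ofReal_inv_of_pos hb0, div_eq_mul_inv]
        ring

end Quasinearly

end

theorem corollary4p2 (m n : ℕ) (hn : 2 ≤ n) (hmn : n ≤ m) (K : ℝ) (hK : 1 ≤ K)
    (Ω : Set (EuclideanSpace ℝ (Fin (m + n)))) (hΩ_open : IsOpen Ω) (hΩ_conn : IsConnected Ω)
    (u : EuclideanSpace ℝ (Fin (m + n)) → EReal) (hu_top : ∀ z ∈ Ω, u z < ⊤)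
    (hu_meas : AEMeasurable u (volume.restrict Ω))
    (ha : ∀ y : EuclideanSpace ℝ (Fin n),
      Quasinearly.IsKQuasinearlySubharmonicOn K (fun x => u (Quasinearly.pair x y))
        {x : EuclideanSpace ℝ (Fin m) | Quasinearly.pair x y ∈ Ω})
    (hb : ∀ x : EuclideanSpace ℝ (Fin m),
      Quasinearly.IsKQuasinearlySubharmonicOn K (fun y => u (Quasinearly.pair x y))
        {y : EuclideanSpace ℝ (Fin n) | Quasinearly.pair x y ∈ Ω})
    (hc : ∃ (φ ϕ : ℝ≥0 ≃o ℝ≥0) (s₀ s₁ : ℕ), s₀ < s₁ ∧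
      (∀ s : ℝ, (s₁ : ℝ) ≤ s →
        2 * K * Quasinearly.invExp ϕ (s - s₀) ≤ Quasinearly.invExp ϕ s) ∧
      IntegrableOn (Quasinearly.integrand m n φ ϕ s₀ s₁) (Ici (Quasinearly.sFive ϕ s₀ s₁))
        volume ∧
      LocallyIntegrableOn
        (fun z => (φ (Quasinearly.logPlus ϕ (Quasinearly.plus (u z))).toNNReal : ℝ)) Ω volume) :
    Quasinearly.IsQuasinearlySubharmonicOn u Ω := by
  open Quasinearly in
  obtain ⟨φ, ϕ, s₀, s₁, -, hc1, hc2, hc3⟩ := hc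
  have hnR : (2 : ℝ) ≤ n := by exact_mod_cast hn
  have hmnR : (n : ℝ) ≤ m := by exact_mod_cast hmn
  have hsurj : ∀ z : EuclideanSpace ℝ (Fin (m + n)), ∃ x y, pair (m := m) (n := n) x y = z :=
    fun z => ⟨_, _, (EuclideanSpace.finAddEquivProd (𝕜 := ℝ) (n := m) (m := n)).symm_apply_apply z⟩
  refine ⟨max 1 (productConst m n K), le_max_left _ _, hu_top, hu_meas, ?_, ?_⟩
  · intro z hz
    obtain ⟨x₀, y₀, rfl⟩ := hsurj z
    obtain ⟨U, hU, hUint⟩ := hc3 _ hz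
    rw [hΩ_open.nhdsWithin_eq hz] at hU
    obtain ⟨ε, hε, hεU⟩ := Metric.mem_nhds_iff.1 (Filter.inter_mem hU (hΩ_open.mem_nhds hz))
    set δ := ε / 8 with hδ
    have hδ0 : 0 < δ := by positivity
    have hmem : ∀ x ∈ Metric.closedBall x₀ (3 * δ), ∀ y ∈ Metric.closedBall y₀ (3 * δ),
        pair x y ∈ Metric.ball (pair x₀ y₀) ε := by
      intro x hx y hy
      have := dist_pair_le x x₀ y y₀
      rw [Metric.mem_closedBall] at hx hy
      rw [Metric.mem_ball]
      linarith
    have hsub : ∀ {N : ℕ} {z : EuclideanSpace ℝ (Fin N)} {c : ℝ}, c ≤ 3 →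
        Metric.closedBall z (c * δ) ⊆ Metric.closedBall z (3 * δ) := fun hc _ hz =>
      Metric.closedBall_subset_closedBall (by nlinarith) hz
    have hxΩ : ∀ y ∈ Metric.closedBall y₀ (3 * δ),
        Metric.closedBall x₀ (3 * δ) ⊆ {x | pair x y ∈ Ω} :=
      fun y hy x hx => (hεU (hmem x hx y hy)).2
    have hyΩ : ∀ x ∈ Metric.closedBall x₀ (3 * δ),
        Metric.closedBall y₀ (3 * δ) ⊆ {y | pair x y ∈ Ω} :=
      fun x hx y hy => (hεU (hmem x hx y hy)).2
    set b := ⌈sFive ϕ s₀ s₁ + 3⌉₊ with hbdef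
    have hbσ : sFive ϕ s₀ s₁ + 3 ≤ b := Nat.le_ceil _
    have hσ : (s₀ : ℝ) + s₁ + 3 ≤ sFive ϕ s₀ s₁ := le_max_left _ _
    have hs₀ : (0 : ℝ) ≤ s₀ := Nat.cast_nonneg _
    have hs₁ : (0 : ℝ) ≤ s₁ := Nat.cast_nonneg _
    have hbpos : 0 < b := by
      have : (0 : ℝ) < b := by linarith
      exact_mod_cast this
    have hseries := summable_innerWeight_mul hn hmn φ ϕ hbσ hc2
    have hgs := summable_innerWeight hn hmn φ ϕ hbpos hseries
    have hhardy := summable_mul_tailSum_rpow (θ := ((n : ℝ) - 1) / ((m : ℝ) - 1))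
      (div_pos (by linarith) (by linarith)) ((div_le_one (by linarith)).2 (by linarith))
      (innerWeight_pos φ ϕ s₀ hbpos) (outerWeight_pos ϕ s₀ b) hgs hseries
    rw [inv_div] at hhardy
    obtain ⟨M, hM⟩ := exists_bound_of_separately_submean hn hmn hK
      (v := fun x y => plus (u (pair x y))) (x₀ := x₀) (y₀ := y₀) hδ0
      (fun y hy => (ha y).submeanOn.mono (hxΩ y hy))
      (fun y hy => measurable_plus.comp_aemeasurable
        ((ha y).measurable.mono_measure (Measure.restrict_mono (hxΩ y hy) le_rfl)))
      (fun y hy => (ha y).lintegral_plus_ne_top (hxΩ y hy))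
      (fun x hx => (hb x).submeanOn.mono (hyΩ x hx))
      (fun x hx => measurable_plus.comp_aemeasurable
        ((hb x).measurable.mono_measure (Measure.restrict_mono (hyΩ x hx) le_rfl)))
      (fun x hx => (hb x).lintegral_plus_ne_top (hyΩ x hx))
      (H := fun x y =>
        ENNReal.ofReal (φ (logPlus ϕ (plus (u (pair x y)))).toNNReal : ℝ))
      (by
        have hUm : ∀ x ∈ Metric.closedBall x₀ (2 * δ), ∀ y ∈ Metric.closedBall y₀ (2 * δ),
            pair x y ∈ U := fun x hx y hy =>
          (hεU (hmem x (hsub (by norm_num) hx) y (hsub (by norm_num) hy))).1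
        rw [← lintegral_prod_symm (fun p => ENNReal.ofReal
          (φ (logPlus ϕ (plus (u (pair p.1 p.2)))).toNNReal : ℝ))
          (aemeasurable_comp_pair hUint.aestronglyMeasurable.aemeasurable.ennreal_ofReal hUm)]
        exact ne_top_of_le_ne_top hUint.lintegral_lt_top.ne (lintegral_prod_pair_le
          (fun z => ENNReal.ofReal (φ (logPlus ϕ (plus (u z))).toNNReal : ℝ)) hUm))
      (level_pos ϕ b) (level_strictMono ϕ b) (tendsto_level_atTop ϕ b)
      (s₀ := s₀) (by
        intro i
        have h := hc1 ((b : ℝ) + (i + s₀ : ℕ)) (by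
          push_cast
          linarith [(Nat.cast_nonneg i : (0 : ℝ) ≤ i)])
        rwa [show (b : ℝ) + (i + s₀ : ℕ) - s₀ = b + i by push_cast; ring] at h)
      (q := fun i => (φ (b + i : ℕ) : ℝ)) (fun i => orderIso_pos φ (by positivity))
      (by
        intro i x y h
        refine ENNReal.ofReal_le_ofReal (NNReal.coe_le_coe.2 (φ.monotone ?_))
        have h' := Real.toNNReal_le_toNNReal (le_logPlus_of_invExp_le ϕ h)
        refine le_trans (le_of_eq ?_) h'
        rw [← Nat.cast_add, Real.toNNReal_natCast])
      (g := innerWeight m φ ϕ s₀ b) (w := outerWeight n ϕ s₀ b) (fun i => rfl) (fun i => rfl)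
      hgs hhardy
    have hcont := (EuclideanSpace.finAddEquivProd (𝕜 := ℝ) (n := m) (m := n)).continuous
    set V : Set (EuclideanSpace ℝ (Fin (m + n))) := EuclideanSpace.finAddEquivProd (𝕜 := ℝ) ⁻¹'
      (Metric.closedBall x₀ δ ×ˢ Metric.closedBall y₀ δ) with hV
    have hVmeas : MeasurableSet V :=
      ((Metric.isClosed_closedBall.prod Metric.isClosed_closedBall).preimage hcont).measurableSet
    have hVnhds : V ∈ nhds (pair x₀ y₀) := by
      refine hcont.continuousAt.preimage_mem_nhds ?_
      have e : EuclideanSpace.finAddEquivProd (𝕜 := ℝ) (pair x₀ y₀) = (x₀, y₀) :=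
        ContinuousLinearEquiv.apply_symm_apply _ _
      rw [e]
      exact prod_mem_nhds (Metric.closedBall_mem_nhds _ hδ0) (Metric.closedBall_mem_nhds _ hδ0)
    have hpairV : ∀ z ∈ V, ∃ x ∈ Metric.closedBall x₀ δ, ∃ y ∈ Metric.closedBall y₀ δ,
        pair x y = z := fun z hz => ⟨_, hz.1, _, hz.2,
      (EuclideanSpace.finAddEquivProd (𝕜 := ℝ) (n := m) (m := n)).symm_apply_apply z⟩
    have hδ3 : ∀ {N : ℕ} {z : EuclideanSpace ℝ (Fin N)},
        Metric.closedBall z δ ⊆ Metric.closedBall z (3 * δ) := fun hz =>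
      Metric.closedBall_subset_closedBall (by linarith) hz
    have hVball : V ⊆ Metric.ball (pair x₀ y₀) ε := by
      intro z hz
      obtain ⟨x, hx, y, hy, rfl⟩ := hpairV z hz
      exact hmem x (hδ3 hx) y (hδ3 hy)
    refine ⟨V, mem_nhdsWithin_of_mem_nhds hVnhds, ?_⟩
    refine IntegrableOn.of_bound ((measure_mono hVball).trans_lt measure_ball_lt_top) ?_ M ?_
    · exact (measurable_plus.comp_aemeasurable (hu_meas.mono_measure (Measure.restrict_mono
        (fun z hz => (hεU (hVball hz)).2) le_rfl))).coe_nnreal_real.aestronglyMeasurable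
    · refine ae_restrict_of_forall_mem hVmeas fun z hz => ?_
      obtain ⟨x, hx, y, hy, rfl⟩ := hpairV z hz
      rw [Real.norm_of_nonneg (NNReal.coe_nonneg _)]
      exact hM x hx y hy
  · intro M hM z r hr hball
    obtain ⟨x₀, y₀, rfl⟩ := hsurj z
    refine (truncate_le_of_separately hK hu_meas ha hb hM x₀ y₀ hr hball).trans ?_
    gcongr
    exact le_max_right _ _
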